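/- Fix a continuous activation $\sigma:\mathbb R\to\mathbb R$ that is not affine (e.g. ReLU) and an order $k\ge 1$; all MLPs are finite alternations of affine maps and entrywise $\sigma$. A tensor $X\in\mathbb R^{n^k\times d}$ assigns a row vector $X_i\in\mathbb R^d$ to every $k$-tuple $i\in[n]^k$. An equivariant linear layer $L_{k\to l}$ maps $X\in\mathbb R^{n^k\times d}$ to the tensor with entries $L(X)_i=\sum_\mu\sum_j B^\mu_{i,j}X_jw_\mu+\sum_\nu C^\nu_i b_\nu$ for $i\in[n]^l$, where $\mu$ runs over the partitions of the $l+k$ index positions, $\nu$ over those of the $l$ index positions, $B^\mu_{i,j}$ (resp. $C^\nu_i$) is $1$ if the equality pattern of $(i,j)$ (resp. $i$) is exactly $\mu$ (resp. $\nu$) and $0$ otherwise, and the weights $w_\mu$ and biases $b_\nu$ do not depend on $n$. A $k$-IGN is a function $\mathrm{MLP}\circ L_{k\to0}\circ L^{(T)}_{k\to k}\circ\sigma\circ\dots\circ\sigma\circ L^{(1)}_{k\to k}$ with values in $\mathbb R$. An equivariant $k$-IGN with residual connections and MLPs is a composition of layers $L_{k\to k}$, the activation $\sigma$, MLPs applied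 to each tuple, and residual connections $X\mapsto X+N(X)$ around such networks. A kernelized attention head with (real) matrices $Q,K,V$ (with optional bias terms after the multiplication) is $$X_i\mapsto\frac{\big(\phi(X_iQ)^\top\sum_{j}\phi(X_jK)\otimes(X_jV)\big)^\top}{\phi(X_iQ)^\top\sum_{l}\phi(X_lK)},\qquad i,j,l\in[n]^k,$$ where either $\phi(x)=\mathrm{elu}(x)+1$ entrywise (Linear Transformer), or $\phi(x)=\frac{e^{-\|x\|_2^2/2}}{\sqrt m}\,[e^{\omega_1^\top x},\dots,e^{\omega_m^\top x}]$ with $m\ge1$ and any fixed $\omega_1,\dots,\omega_m$ (Performer, for every realization of its random directions). A kernelized $\mathcal A_k$ is a composition of layers $\sum_h \mathrm{head}_h(X)\,O_h$ (in particular, a single head), tuple-wise MLPs and residual connections; its graph-level output, when needed, is an MLP with values in $\mathbb R$ applied to the sum of the final features of all tuples. A graph $G$ on node set $[n]$ with node attributes in $\mathbb R^a$ ($a\ge0$) is turned into a tensor by giving each $k$-tuple $i$ the feature that lists, for all positions $r,s$, the attribute of $i_r$ if $i_r=i_s$ (and $0$ otherwise), the indicator of $i_r\sim i_s$, and the indicator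 of $i_r=i_s$; this encodes the isomorphism type of the tuple. A model class distinguishes two graphs if some model of the class, applied to these tensors, gives the two graphs different outputs. Theorem. (1) For all $n,d,e$, every kernelized $\mathcal A_k$ from $\mathbb R^{n^k\times d}$ to $\mathbb R^{n^k\times e}$, every compact $S\subset\mathbb R^{n^k\times d}$ and every $\varepsilon>0$ there is an equivariant $k$-IGN $N$ with residual connections and MLPs such that every entry of $N(X)-\mathcal A_k(X)$ has absolute value less than $\varepsilon$, for all $X\in S$. (2) Kernelized $\mathcal A_k$ is at most as powerful as $k$-IGN: any two attributed graphs (with attributes in the same $\mathbb R^a$, possibly of different sizes) that are distinguished by kernelized $\mathcal A_k$ are distinguished by $k$-IGN. If $k\ge2$ it is strictly less powerful: for every $a$ there are two graphs with attributes in $\mathbb R^a$ on the same number of nodes which some $k$-IGN distinguishes but no kernelized $\mathcal A_k$ does. -/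

import Mathlib

open Matrix

noncomputable section

/-! ### Tensors and multilayer perceptrons -/

/-- Order-`k` tensors `X ∈ ℝ^{n^k × d}`: one feature (row) vector in `ℝ^d` for every `k`-tuple
of nodes. -/
abbrev TupleTensor (n k d : ℕ) : Type := (Fin k → Fin n) → Fin d → ℝ

/-- Multilayer perceptrons `ℝ^d → ℝ^e` of arbitrary depth and width: affine maps
alternating with an entrywise activation. -/
inductive MLP : ℕ → ℕ → Type
  | affine {d e : ℕ} (W : Matrix (Fin d) (Fin e) ℝ) (b : Fin e → ℝ) : MLP d e
  | layer {d e f : ℕ} (W : Matrix (Fin d) (Fin e) ℝ) (b : Fin e → ℝ) (M : MLP e f) : MLP d f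

/-- The function computed by an MLP with activation `σ`. -/
def MLP.eval (σ : ℝ → ℝ) {d e : ℕ} : MLP d e → (Fin d → ℝ) → (Fin e → ℝ)
  | .affine W b, x => x ᵥ* W + b
  | .layer W b M, x => M.eval σ (fun c => σ ((x ᵥ* W + b) c))

/-! ### Invariant graph networks -/

/-- The equality patterns on a finite index set are finite in number (Bell number). -/
instance setoidFintype (α : Type) [Finite α] : Fintype (Setoid α) :=
  haveI : Finite (Setoid α) :=
    Finite.of_injective (fun s : Setoid α => (fun a b => s a b : α → α → Prop))
      (fun _ _ h => Setoid.ext fun a b => iff_of_eq (congrFun (congrFun h a) b))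
  Fintype.ofFinite _

open Classical in
/-- The basis tensor attached to an equality pattern `μ` (a partition of the index set `ι`):
its entry at a multi-index `a` is `1` if exactly those entries of `a` coincide that `μ`
identifies, and `0` otherwise. -/
def basisTensor {ι : Type} {n : ℕ} (μ : Setoid ι) (a : ι → Fin n) : ℝ :=
  if Setoid.ker a = μ then 1 else 0

/-- The weights `w_μ` and biases `b_ν` of an equivariant linear layer
`L_{k→l} : ℝ^{n^k × d} → ℝ^{n^l × e}`; there are `bell (l + k)` of the former and `bell l` of the
latter, and they do not depend on `n`. -/
structure EquivLayer (k l d e : ℕ) where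
  w : Setoid (Fin l ⊕ Fin k) → Matrix (Fin d) (Fin e) ℝ
  b : Setoid (Fin l) → Fin e → ℝ

/-- `L(X)_i = ∑_μ ∑_j B^μ_{i,j} X_j w_μ + ∑_ν C^ν_i b_ν`. -/
def EquivLayer.eval {k l d e n : ℕ} (L : EquivLayer k l d e) (X : TupleTensor n k d) :
    TupleTensor n l e := fun i =>
  (∑ μ, ∑ j, basisTensor μ (Sum.elim i j) • (X j ᵥ* L.w μ)) + ∑ ν, basisTensor ν i • L.b ν

/-- The equivariant part `L^{(T)} ∘ σ ∘ ⋯ ∘ σ ∘ L^{(1)}` of a `k`-IGN, `T ≥ 1`. -/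
inductive IGNTrunk (k : ℕ) : ℕ → ℕ → Type
  | last {d e : ℕ} (L : EquivLayer k k d e) : IGNTrunk k d e
  | layer {d e f : ℕ} (L : EquivLayer k k d e) (N : IGNTrunk k e f) : IGNTrunk k d f

def IGNTrunk.eval (σ : ℝ → ℝ) {k d e n : ℕ} :
    IGNTrunk k d e → TupleTensor n k d → TupleTensor n k e
  | .last L, X => L.eval X
  | .layer L N, X => N.eval σ (fun i c => σ (L.eval X i c))

/-- A `k`-IGN `MLP ∘ L_{k→0} ∘ L^{(T)} ∘ σ ∘ ⋯ ∘ σ ∘ L^{(1)}` with scalar output. -/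
structure IGN (k d : ℕ) where
  width : ℕ
  trunk : IGNTrunk k d width
  inv : EquivLayer k 0 width 1
  mlp : MLP 1 1

def IGN.eval (σ : ℝ → ℝ) {k d n : ℕ} (F : IGN k d) (X : TupleTensor n k d) : ℝ :=
  F.mlp.eval σ (F.inv.eval (F.trunk.eval σ X) ![]) 0

/-- Equivariant `k`-IGNs with residual connections and (tuple-wise) MLPs. -/
inductive ResIGN (k : ℕ) : ℕ → ℕ → Type
  | lin {d e : ℕ} (L : EquivLayer k k d e) : ResIGN k d e
  | act (d : ℕ) : ResIGN k d d
  | mlp {d e : ℕ} (M : MLP d e) : ResIGN k d e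
  | res {d : ℕ} (N : ResIGN k d d) : ResIGN k d d
  | comp {d e f : ℕ} (N₂ : ResIGN k e f) (N₁ : ResIGN k d e) : ResIGN k d f

def ResIGN.eval (σ : ℝ → ℝ) {k d e n : ℕ} :
    ResIGN k d e → TupleTensor n k d → TupleTensor n k e
  | .lin L, X => L.eval X
  | .act _, X => fun i c => σ (X i c)
  | .mlp M, X => fun i => M.eval σ (X i)
  | .res N, X => X + N.eval σ X
  | .comp N₂ N₁, X => N₂.eval σ (N₁.eval σ X)

/-! ### Kernelized order-`k` transformers -/

/-- The exponential linear unit. -/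
def elu (x : ℝ) : ℝ := if 0 < x then x else Real.exp x - 1

/-- The feature maps `φ : ℝ^p → ℝ^m` of kernelized attention: that of the Linear Transformer
(where `m = p`), and that of the Performer for each realization `ω_1, …, ω_m ∈ ℝ^p` of its
random directions. -/
inductive FeatureMap : ℕ → ℕ → Type
  | linearTransformer {p : ℕ} (hp : 0 < p) : FeatureMap p p
  | performer {p m : ℕ} (hm : 0 < m) (ω : Fin m → Fin p → ℝ) : FeatureMap p m

def FeatureMap.eval {p m : ℕ} : FeatureMap p m → (Fin p → ℝ) → (Fin m → ℝ)
  | .linearTransformer _, x => fun r => elu (x r) + 1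
  | .performer _ ω, x => fun r =>
      Real.exp (-(∑ c, x c ^ 2) / 2) / Real.sqrt m * Real.exp (ω r ⬝ᵥ x)

/-- One head of kernelized attention on `d`-dimensional features with value dimension `v`:
latent dimension `p`, feature dimension `m`, query, key and value matrices with bias terms. -/
structure KernelHead (d v : ℕ) where
  p : ℕ
  m : ℕ
  φ : FeatureMap p m
  Q : Matrix (Fin d) (Fin p) ℝ
  K : Matrix (Fin d) (Fin p) ℝ
  V : Matrix (Fin d) (Fin v) ℝ
  bQ : Fin p → ℝ
  bK : Fin p → ℝ
  bV : Fin v → ℝ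

/-- Kernelized attention
`X_i ↦ (φ(X_i Q)ᵀ ∑_j φ(X_j K) ⊗ (X_j V))ᵀ / (φ(X_i Q)ᵀ ∑_l φ(X_l K))`,
the sums running over all `n^k` tuples. -/
def KernelHead.eval {d v n k : ℕ} (A : KernelHead d v) (X : TupleTensor n k d) :
    TupleTensor n k v := fun i =>
  let q : Fin A.m → ℝ := A.φ.eval (X i ᵥ* A.Q + A.bQ)
  let key : (Fin k → Fin n) → Fin A.m → ℝ := fun j => A.φ.eval (X j ᵥ* A.K + A.bK)
  let val : (Fin k → Fin n) → Fin v → ℝ := fun j => X j ᵥ* A.V + A.bV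
  (q ⬝ᵥ ∑ l, key l)⁻¹ • (q ᵥ* ∑ j, Matrix.vecMulVec (key j) (val j))

/-- Kernelized order-`k` transformers: compositions of (multi-head) kernelized attention layers,
tuple-wise MLPs and residual connections. One head with `O = 1` is a single-head layer. -/
inductive KernelTransformer : ℕ → ℕ → Type
  | attn {d v e : ℕ} (H : ℕ) (head : Fin H → KernelHead d v)
      (O : Fin H → Matrix (Fin v) (Fin e) ℝ) : KernelTransformer d e
  | mlp {d e : ℕ} (M : MLP d e) : KernelTransformer d e
  | res {d : ℕ} (A : KernelTransformer d d) : KernelTransformer d d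
  | comp {d e f : ℕ} (A₂ : KernelTransformer e f) (A₁ : KernelTransformer d e) :
      KernelTransformer d f

def KernelTransformer.eval (σ : ℝ → ℝ) {d e n k : ℕ} :
    KernelTransformer d e → TupleTensor n k d → TupleTensor n k e
  | .attn _ head O, X => fun i => ∑ h, (head h).eval X i ᵥ* O h
  | .mlp M, X => fun i => M.eval σ (X i)
  | .res A, X => X + A.eval σ X
  | .comp A₂ A₁, X => A₂.eval σ (A₁.eval σ X)

/-- A kernelized transformer with permutation invariant graph-level output: the final tuple
features are summed over all tuples and passed through an MLP. -/
structure GraphKernelTransformer (d : ℕ) where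
  width : ℕ
  net : KernelTransformer d width
  mlp : MLP width 1

def GraphKernelTransformer.eval (σ : ℝ → ℝ) {d n k : ℕ} (A : GraphKernelTransformer d)
    (X : TupleTensor n k d) : ℝ :=
  A.mlp.eval σ (∑ i, A.net.eval σ X i) 0

/-! ### Graphs and their distinguishability -/

/-- Graphs on `n` nodes with node attributes in `ℝ^a` (`a = 0`: plain graphs). -/
structure AttrGraph (n a : ℕ) where
  graph : SimpleGraph (Fin n)
  attr : Fin n → Fin a → ℝ

open Classical in
/-- The `a + 2` channels attached to a pair of nodes: the attributes (on the diagonal), the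
adjacency relation, and the equality relation. -/
def AttrGraph.pairFeature {n a : ℕ} (G : AttrGraph n a) (u v : Fin n) : Fin (a + 2) → ℝ :=
  Fin.append (fun c => if u = v then G.attr u c else 0)
    ![if G.graph.Adj u v then 1 else 0, if u = v then 1 else 0]

/-- The initial feature of a `k`-tuple, which encodes its isomorphism type: it lists the channels
of the pair `(i_r, i_s)` for all `r, s`. -/
def AttrGraph.tupleInit {n a : ℕ} (k : ℕ) (G : AttrGraph n a) :
    TupleTensor n k (k * k * (a + 2)) := fun i c =>
  let rsw := finProdFinEquiv.symm c
  let rs := finProdFinEquiv.symm rsw.1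
  G.pairFeature (i rs.1) (i rs.2) rsw.2

/-- Some `k`-IGN with activation `σ` gives the two graphs different outputs. -/
def IGNDistinguishes (σ : ℝ → ℝ) (k : ℕ) {n n' a : ℕ} (G : AttrGraph n a) (G' : AttrGraph n' a) :
    Prop :=
  ∃ F : IGN k (k * k * (a + 2)), F.eval σ (G.tupleInit k) ≠ F.eval σ (G'.tupleInit k)

/-- Some kernelized order-`k` transformer (whose MLPs have activation `σ`) gives the two graphs
different outputs. -/
def KernelTransformerDistinguishes (σ : ℝ → ℝ) (k : ℕ) {n n' a : ℕ} (G : AttrGraph n a)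
    (G' : AttrGraph n' a) : Prop :=
  ∃ A : GraphKernelTransformer (k * k * (a + 2)),
    A.eval σ (G.tupleInit k) ≠ A.eval σ (G'.tupleInit k)

end

/-! A kernelized head at the tuple `i` depends only on `X i` and on sums over all tuples `j` of a
continuous function of `X j`, namely the key and the product of key and value. Such a sum is one
equivariant linear layer between two tuple-wise continuous maps, so everything reduces to showing
that trunks (alternations of equivariant layers and `σ`) approximate tuple-wise continuous maps and
compose. Approximation is uniform on compact sets and takes place in the product over all numbers of
nodes `n`, so that one choice of weights serves every `n`; this is what allows graphs of different
sizes to be compared.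

Since `σ` is not affine, some mixed second difference of it is nonzero. Smoothing `σ` twice by
sliding integrals turns that difference into a second derivative, and rescaled second difference
quotients put `x ^ 2`, hence `x`, into the closed span of the functions `σ (a x + b)`
(`sq_mem_ridgeSpan`, `id_mem_ridgeSpan`). The identity lets trunks be joined and features be carried
along; squares give products; Stone–Weierstrass then gives all continuous tuple-wise maps
(`tuplewiseApprox_of_continuous`). Depth is essential: a polynomial `σ` is allowed, and one hidden
layer would not suffice for it. Positivity of the feature maps makes the attention denominator
harmless on compact sets (`trunkApprox_attention`), and induction over the architecture gives
`KernelTransformer.trunkApprox_eval`. Distinguishing two graphs is an open condition, so a trunk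
close enough to the transformer also distinguishes them.

For strictness, a kernelized transformer sees only the multiset of tuple features. Take the stars
indexed by binary words of length `k + 1`, separated by the parity of the word. A `k`-tuple misses
some leaf label, and flipping that letter in all its entries is a bijection between even and odd
tuples that preserves isomorphism types. A `k`-IGN with `k ≥ 2` computes degrees, however, and only
the even graph has a node of degree 2. -/

noncomputable section

open Topology Filter

/-! ### Functions of one variable generated by an activation -/

/-- The closed span, in the compact-open topology, of the functions `x ↦ σ (a x + b)`. -/
def ridgeSpan (σ : C(ℝ, ℝ)) : Submodule ℝ C(ℝ, ℝ) :=
  (Submodule.span ℝ (Set.range fun p : ℝ × ℝ =>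
    σ.comp ⟨fun x => p.1 * x + p.2, by fun_prop⟩)).topologicalClosure

theorem isClosed_ridgeSpan (σ : C(ℝ, ℝ)) : IsClosed (ridgeSpan σ : Set C(ℝ, ℝ)) :=
  Submodule.isClosed_topologicalClosure _

theorem self_mem_ridgeSpan (σ : C(ℝ, ℝ)) : σ ∈ ridgeSpan σ := by
  apply Submodule.le_topologicalClosure
  apply Submodule.subset_span
  exact ⟨(1, 0), by ext x; simp⟩

theorem comp_affine_mem_ridgeSpan {σ g : C(ℝ, ℝ)} (hg : g ∈ ridgeSpan σ) (a b : ℝ) :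
    g.comp ⟨fun x => a * x + b, by fun_prop⟩ ∈ ridgeSpan σ := by
  set A : C(ℝ, ℝ) := ⟨fun x => a * x + b, by fun_prop⟩
  have hcont : Continuous fun h : C(ℝ, ℝ) => h.comp A := A.continuous_precomp
  refine map_mem_closure (f := fun h : C(ℝ, ℝ) => h.comp A) hcont hg fun h hh => ?_
  induction hh using Submodule.span_induction with
  | mem h hh =>
    obtain ⟨p, rfl⟩ := hh
    refine Submodule.subset_span ⟨(p.1 * a, p.1 * b + p.2), ?_⟩
    ext x
    simp only [ContinuousMap.comp_apply, ContinuousMap.coe_mk, A]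
    ring_nf
  | zero => exact Submodule.zero_mem _
  | add f g _ _ hf hg => exact Submodule.add_mem _ hf hg
  | smul c f _ hf => exact Submodule.smul_mem _ c hf

/-- A closed subspace contains the average of a continuous family of its members. -/
theorem integral_mem_of_isClosed {R : Submodule ℝ C(ℝ, ℝ)} (hR : IsClosed (R : Set C(ℝ, ℝ)))
    (G : C(ℝ × ℝ, ℝ)) (hG : ∀ u, (⟨fun x => G (x, u), by fun_prop⟩ : C(ℝ, ℝ)) ∈ R)
    (I : C(ℝ, ℝ)) (hI : ∀ x, I x = ∫ u in (0 : ℝ)..1, G (x, u)) : I ∈ R := by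
  -- Left Riemann sums with `N + 1` pieces lie in `R`; uniform continuity of `G` on `K × [0, 1]`
  -- makes them converge uniformly on `K`.
  let S : ℕ → C(ℝ, ℝ) := fun N => ∑ i ∈ Finset.range (N + 1),
    (1 / ((N : ℝ) + 1)) • (⟨fun x => G (x, i / ((N : ℝ) + 1)), by fun_prop⟩ : C(ℝ, ℝ))
  have hS : ∀ N, S N ∈ R := fun N =>
    Submodule.sum_mem _ fun i _ => Submodule.smul_mem _ _ (hG _)
  refine hR.mem_of_tendsto (f := S) (b := atTop) ?_ (Eventually.of_forall hS)
  rw [ContinuousMap.tendsto_iff_forall_isCompact_tendstoUniformlyOn]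
  intro K hK
  rw [Metric.tendstoUniformlyOn_iff]
  intro ε hε
  have huc := (hK.prod (isCompact_Icc (a := (0 : ℝ)) (b := 1))).uniformContinuousOn_of_continuous
    G.continuous.continuousOn
  obtain ⟨δ, hδ, hd⟩ := Metric.uniformContinuousOn_iff.1 huc (ε / 2) (by positivity)
  obtain ⟨N₀, hN₀⟩ := exists_nat_one_div_lt hδ
  filter_upwards [eventually_ge_atTop N₀] with N hN x hx
  have hpos : (0 : ℝ) < (N : ℝ) + 1 := by positivity
  have hstep : 1 / ((N : ℝ) + 1) < δ :=
    lt_of_le_of_lt (one_div_le_one_div_of_le (by positivity) (by gcongr)) hN₀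
  have hint : ∀ a b : ℝ, IntervalIntegrable (fun u => G (x, u)) MeasureTheory.volume a b :=
    fun a b => (by fun_prop : Continuous fun u => G (x, u)).intervalIntegrable _ _
  have hsplit : I x = ∑ i ∈ Finset.range (N + 1),
      ∫ u in (i / ((N : ℝ) + 1))..((i + 1 : ℕ) / ((N : ℝ) + 1)), G (x, u) := by
    rw [intervalIntegral.sum_integral_adjacent_intervals
      (a := fun i : ℕ => (i : ℝ) / ((N : ℝ) + 1)) (fun i _ => hint _ _), hI]
    congr 1
    · simp
    · push_cast; field_simp
  have hterm : ∀ i ∈ Finset.range (N + 1),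
      ‖(∫ u in (i / ((N : ℝ) + 1))..((i + 1 : ℕ) / ((N : ℝ) + 1)), G (x, u)) -
        1 / ((N : ℝ) + 1) * G (x, i / ((N : ℝ) + 1))‖ ≤ ε / 2 * (1 / ((N : ℝ) + 1)) := by
    intro i hi
    have hi' : (i : ℝ) + 1 ≤ (N : ℝ) + 1 := by
      have := Finset.mem_range.1 hi
      exact_mod_cast this
    have hlen : ((i + 1 : ℕ) : ℝ) / ((N : ℝ) + 1) - i / ((N : ℝ) + 1) = 1 / ((N : ℝ) + 1) := by
      push_cast; ring
    have hconst : 1 / ((N : ℝ) + 1) * G (x, i / ((N : ℝ) + 1)) =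
        ∫ u in (i / ((N : ℝ) + 1))..((i + 1 : ℕ) / ((N : ℝ) + 1)),
          G (x, i / ((N : ℝ) + 1)) := by
      rw [intervalIntegral.integral_const, hlen, smul_eq_mul]
    rw [hconst, ← intervalIntegral.integral_sub (hint _ _) (by simp)]
    refine (intervalIntegral.norm_integral_le_of_norm_le_const (C := ε / 2) ?_).trans ?_
    · intro u hu
      have hle : (i : ℝ) / ((N : ℝ) + 1) ≤ ((i + 1 : ℕ) : ℝ) / ((N : ℝ) + 1) := by
        have : (0 : ℝ) < 1 / ((N : ℝ) + 1) := by positivity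
        linarith
      rw [Set.uIoc_of_le hle] at hu
      have h0 : 0 ≤ (i : ℝ) / ((N : ℝ) + 1) := by positivity
      have h1 : ((i + 1 : ℕ) : ℝ) / ((N : ℝ) + 1) ≤ 1 := by
        rw [div_le_one hpos]; push_cast; exact hi'
      rw [← dist_eq_norm]
      refine (hd (x, u) ⟨hx, ⟨h0.trans hu.1.le, hu.2.trans h1⟩⟩ (x, i / ((N : ℝ) + 1))
        ⟨hx, ⟨h0, hle.trans h1⟩⟩ ?_).le
      rw [Prod.dist_eq, dist_self, Real.dist_eq, max_lt_iff]
      refine ⟨hδ, ?_⟩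
      rw [abs_of_nonneg (by linarith [hu.1])]
      linarith [hu.2]
    · rw [hlen, abs_of_pos (by positivity)]
  have hSx : S N x = ∑ i ∈ Finset.range (N + 1),
      1 / ((N : ℝ) + 1) * G (x, i / ((N : ℝ) + 1)) := by
    simp [S, ContinuousMap.sum_apply]
  rw [dist_eq_norm, hsplit, hSx, ← Finset.sum_sub_distrib]
  refine (norm_sum_le_of_le _ hterm).trans_lt ?_
  rw [Finset.sum_const, Finset.card_range, nsmul_eq_mul]
  push_cast
  have : ((N : ℝ) + 1) * (ε / 2 * (1 / ((N : ℝ) + 1))) = ε / 2 := by field_simp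
  rw [this]
  linarith

/-- The sliding integral `x ↦ ∫ t in x..x+s, g t`. -/
def slidingIntegral (s : ℝ) (g : C(ℝ, ℝ)) : C(ℝ, ℝ) :=
  ⟨fun x => (∫ t in (0 : ℝ)..(x + s), g t) - ∫ t in (0 : ℝ)..x, g t, by
    have h : Continuous fun x => ∫ t in (0 : ℝ)..x, g t :=
      intervalIntegral.continuous_primitive (fun a b => g.continuous.intervalIntegrable a b) 0
    exact (h.comp (continuous_add_const s)).sub h⟩

theorem hasDerivAt_slidingIntegral (s : ℝ) (g : C(ℝ, ℝ)) (x : ℝ) :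
    HasDerivAt (slidingIntegral s g) (g (x + s) - g x) x := by
  have h : ∀ y, HasDerivAt (fun x => ∫ t in (0 : ℝ)..x, g t) (g y) y := fun y =>
    intervalIntegral.integral_hasDerivAt_right (g.continuous.intervalIntegrable _ _)
      (g.continuous.stronglyMeasurableAtFilter _ _) g.continuous.continuousAt
  exact ((h (x + s)).comp_add_const x s).sub (h x)

/-- Substituting `t = x + s u` writes the sliding integral as an average of translates of `g` over
`u ∈ [0, 1]`. This gains a derivative without leaving the closed span. -/
theorem slidingIntegral_mem_ridgeSpan {σ g : C(ℝ, ℝ)} (hg : g ∈ ridgeSpan σ) (s : ℝ) :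
    slidingIntegral s g ∈ ridgeSpan σ := by
  refine integral_mem_of_isClosed (isClosed_ridgeSpan σ)
    ⟨fun p => s * g (p.1 + s * p.2), by fun_prop⟩ (fun u => ?_) _ (fun x => ?_)
  · convert Submodule.smul_mem _ s (comp_affine_mem_ridgeSpan hg 1 (s * u)) using 1
    ext x
    simp
  · simp only [slidingIntegral, ContinuousMap.coe_mk]
    rw [intervalIntegral.integral_interval_sub_left (g.continuous.intervalIntegrable _ _)
      (g.continuous.intervalIntegrable _ _), intervalIntegral.integral_const_mul,
      intervalIntegral.mul_integral_comp_add_mul]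
    simp

/-- A continuous function with vanishing mixed second differences is affine. -/
theorem affine_of_mixed_difference_eq_zero (σ : C(ℝ, ℝ))
    (h : ∀ x r s, σ (x + s + r) - σ (x + s) - (σ (x + r) - σ x) = 0) :
    ∃ a b : ℝ, ∀ x, σ x = a * x + b := by
  let f : ℝ →+ ℝ :=
    { toFun := fun x => σ x - σ 0
      map_zero' := by simp
      map_add' := fun x y => by have := h 0 y x; simp at this; linarith }
  have hf : Continuous f := σ.continuous.sub continuous_const
  refine ⟨σ 1 - σ 0, σ 0, fun x => ?_⟩
  have h1 := map_real_smul f hf x 1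
  simp only [smul_eq_mul, mul_one] at h1
  change σ x - σ 0 = x * (σ 1 - σ 0) at h1
  linarith

/-- Second symmetric difference quotients converge to the second derivative. -/
theorem tendsto_symmetric_second_difference {h h' : ℝ → ℝ} {x₀ c : ℝ}
    (hh : ∀ x, HasDerivAt h (h' x) x) (hc : HasDerivAt h' c x₀) :
    Tendsto (fun u => (h (x₀ + u) + h (x₀ - u) - 2 * h x₀) / u ^ 2) (𝓝[≠] 0) (𝓝 c) := by
  have hd : ∀ u, HasDerivAt (fun u => h (x₀ + u) + h (x₀ - u) - 2 * h x₀)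
      (h' (x₀ + u) - h' (x₀ - u)) u := fun u => by
    have h1 : HasDerivAt (fun u => h (x₀ + u)) (h' (x₀ + u)) u := (hh _).comp_const_add x₀ u
    have h2 : HasDerivAt (fun u => h (x₀ - u)) (-h' (x₀ - u)) u := (hh _).comp_const_sub x₀ u
    simpa [sub_eq_add_neg] using (h1.add h2).sub_const (2 * h x₀)
  have hd2 : ∀ u : ℝ, HasDerivAt (fun u => u ^ 2) (2 * u) u := fun u => by
    simpa using hasDerivAt_pow 2 u
  -- After one use of l'Hôpital's rule the quotient is a symmetric difference quotient of `h'`, so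
  -- differentiability of `h'` at the single point `x₀` is enough.
  have hslope : Tendsto (fun u => (h' (x₀ + u) - h' (x₀ - u)) / (2 * u)) (𝓝[≠] 0) (𝓝 c) := by
    have h1 : HasDerivAt (fun u => h' (x₀ + u)) c 0 :=
      HasDerivAt.comp_const_add x₀ 0 (by simpa using hc)
    have h2 : HasDerivAt (fun u => h' (x₀ - u)) (-c) 0 :=
      HasDerivAt.comp_const_sub x₀ 0 (by simpa using hc)
    have h3 := (hasDerivAt_iff_tendsto_slope.1 (h1.sub h2)).const_mul (1 / 2)
    have h4 : 1 / 2 * (c - -c) = c := by ring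
    rw [h4] at h3
    refine h3.congr' (eventually_nhdsWithin_of_forall fun u hu => ?_)
    simp [slope_def_field]
    field_simp
  refine HasDerivAt.lhopital_zero_nhdsNE (Eventually.of_forall hd) (Eventually.of_forall hd2)
    ?_ ?_ ?_ hslope
  · filter_upwards [self_mem_nhdsWithin] with u hu
    simpa using hu
  · have := (hd 0).continuousAt.tendsto
    simp only [add_zero, sub_zero] at this
    have h0 : h x₀ + h x₀ - 2 * h x₀ = 0 := by ring
    rw [h0] at this
    exact this.mono_left nhdsWithin_le_nhds
  · have := (hd2 0).continuousAt.tendsto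
    simp only [ne_eq, OfNat.ofNat_ne_zero, not_false_eq_true, zero_pow] at this
    exact this.mono_left nhdsWithin_le_nhds

/-- The double sliding integral `h` of `σ` has second derivative at `x₀` equal to a nonzero mixed
difference `c` of `σ`. Hence `t⁻² (h (x₀ + t x) + h (x₀ - t x) - 2 h x₀)` tends to `c x ^ 2` as `t →
0`, uniformly on compact sets. -/
theorem sq_mem_ridgeSpan {σ : C(ℝ, ℝ)} (hσ : ¬ ∃ a b : ℝ, ∀ x, σ x = a * x + b) :
    (⟨fun x => x ^ 2, by fun_prop⟩ : C(ℝ, ℝ)) ∈ ridgeSpan σ := by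
  have hex : ∃ x r s, σ (x + s + r) - σ (x + s) - (σ (x + r) - σ x) ≠ 0 := by
    by_contra! hcon
    exact hσ (affine_of_mixed_difference_eq_zero σ hcon)
  obtain ⟨x₀, r, s, hne⟩ := hex
  set c := σ (x₀ + s + r) - σ (x₀ + s) - (σ (x₀ + r) - σ x₀)
  set g := slidingIntegral r σ
  set h := slidingIntegral s g
  have hmem : h ∈ ridgeSpan σ :=
    slidingIntegral_mem_ridgeSpan (slidingIntegral_mem_ridgeSpan (self_mem_ridgeSpan σ) r) s
  have hd : HasDerivAt (fun x => g (x + s) - g x) c x₀ :=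
    ((hasDerivAt_slidingIntegral r σ (x₀ + s)).comp_add_const x₀ s).sub
      (hasDerivAt_slidingIntegral r σ x₀)
  have hlim := tendsto_symmetric_second_difference (hasDerivAt_slidingIntegral s g) hd
  set q : ℝ → ℝ := fun u => (h (x₀ + u) + h (x₀ - u) - 2 * h x₀) / u ^ 2
  -- Filling the gap of `q` at `0` by its limit `c` makes `ψ` a continuous path in `C(ℝ, ℝ)` that
  -- ends at `c x ^ 2`.
  have hE : Continuous (Function.update q 0 c) := by
    rw [continuous_iff_continuousAt]
    intro u
    rcases eq_or_ne u 0 with rfl | hu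
    · exact continuousAt_update_same.2 hlim
    · rw [continuousAt_update_of_ne hu]
      have : ContinuousAt (fun u : ℝ => h (x₀ + u) + h (x₀ - u) - 2 * h x₀) u := by fun_prop
      exact this.div (by fun_prop) (by positivity)
  let ψ : ℝ → C(ℝ, ℝ) := fun t => ⟨fun x => Function.update q 0 c (t * x) * x ^ 2, by fun_prop⟩
  have hψ : Continuous ψ := by
    refine ContinuousMap.continuous_of_continuous_uncurry _ ?_
    change Continuous fun p : ℝ × ℝ => Function.update q 0 c (p.1 * p.2) * p.2 ^ 2
    fun_prop
  have hψmem : ∀ t ≠ 0, ψ t ∈ ridgeSpan σ := by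
    intro t ht
    have h1 := comp_affine_mem_ridgeSpan hmem t x₀
    have h2 := comp_affine_mem_ridgeSpan hmem (-t) x₀
    have h3 := comp_affine_mem_ridgeSpan hmem 0 x₀
    convert Submodule.smul_mem _ (t ^ 2)⁻¹
      (Submodule.sub_mem _ (Submodule.add_mem _ h1 h2) (Submodule.smul_mem _ 2 h3)) using 1
    ext x
    rcases eq_or_ne x 0 with rfl | hx
    · simp [ψ]; right; ring
    · have htx : t * x ≠ 0 := mul_ne_zero ht hx
      simp only [ψ, ContinuousMap.coe_mk, Function.update_of_ne htx, q, ContinuousMap.smul_apply,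
        ContinuousMap.sub_apply, ContinuousMap.add_apply, ContinuousMap.comp_apply, smul_eq_mul]
      rw [show -t * x + x₀ = x₀ - t * x by ring, show t * x + x₀ = x₀ + t * x by ring,
        show 0 * x + x₀ = x₀ by ring]
      field_simp
  have h0 : ψ 0 ∈ ridgeSpan σ :=
    (isClosed_ridgeSpan σ).mem_of_tendsto
      (hψ.continuousAt.tendsto.mono_left (nhdsWithin_le_nhds (s := {0}ᶜ)))
      (eventually_nhdsWithin_of_forall hψmem)
  convert Submodule.smul_mem _ c⁻¹ h0 using 1
  ext x
  simp [ψ, hne]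

/-- `2 x = (x + 1) ^ 2 - x ^ 2 - 1`, the constant being the square precomposed with `0 * x + 1`. -/
theorem id_mem_ridgeSpan {σ : C(ℝ, ℝ)} (hσ : ¬ ∃ a b : ℝ, ∀ x, σ x = a * x + b) :
    ContinuousMap.id ℝ ∈ ridgeSpan σ := by
  have h := sq_mem_ridgeSpan hσ
  have h1 := comp_affine_mem_ridgeSpan h 1 1
  have h2 := comp_affine_mem_ridgeSpan h 0 1
  convert Submodule.smul_mem _ (2⁻¹ : ℝ) (Submodule.sub_mem _ (Submodule.sub_mem _ h1 h) h2)
    using 1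
  ext x
  simp
  ring

/-! ### Equivariant layers -/

theorem sum_basisTensor_smul {ι : Type} [Finite ι] {n : ℕ} {M : Type*} [AddCommGroup M]
    [Module ℝ M] (a : ι → Fin n) (f : Setoid ι → M) :
    ∑ μ, basisTensor μ a • f μ = f (Setoid.ker a) := by
  classical
  rw [Finset.sum_eq_single (Setoid.ker a)]
  · simp [basisTensor]
  · intro μ _ hμ
    simp [basisTensor, hμ.symm]
  · simp

/-- Each multi-index has exactly one equality pattern, so the sums over patterns collapse. All later
computations with layers use this form. -/
theorem EquivLayer.eval_apply {k l d e n : ℕ} (L : EquivLayer k l d e) (X : TupleTensor n k d)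
    (i : Fin l → Fin n) :
    L.eval X i = (∑ j, X j ᵥ* L.w (Setoid.ker (Sum.elim i j))) + L.b (Setoid.ker i) := by
  rw [EquivLayer.eval, sum_basisTensor_smul, Finset.sum_comm]
  congr 1
  refine Finset.sum_congr rfl fun j _ => ?_
  exact sum_basisTensor_smul (Sum.elim i j) fun μ => X j ᵥ* L.w μ

theorem EquivLayer.continuous_eval {k l d e n : ℕ} (L : EquivLayer k l d e) :
    Continuous (L.eval : TupleTensor n k d → TupleTensor n l e) := by
  refine continuous_pi fun i => ?_
  simp only [EquivLayer.eval_apply]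
  refine Continuous.add (continuous_finsetSum _ fun j _ => ?_) continuous_const
  exact Continuous.matrix_vecMul (continuous_apply j) continuous_const

/-- The layer followed by a tuple-wise affine map. -/
def EquivLayer.postAffine {k l d e f : ℕ} (L : EquivLayer k l d e) (W : Matrix (Fin e) (Fin f) ℝ)
    (b : Fin f → ℝ) : EquivLayer k l d f where
  w μ := L.w μ * W
  b ν := L.b ν ᵥ* W + b

theorem EquivLayer.postAffine_eval {k l d e f n : ℕ} (L : EquivLayer k l d e)
    (W : Matrix (Fin e) (Fin f) ℝ) (b : Fin f → ℝ) (X : TupleTensor n k d) (i : Fin l → Fin n) :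
    (L.postAffine W b).eval X i = L.eval X i ᵥ* W + b := by
  simp only [EquivLayer.eval_apply, EquivLayer.postAffine, Matrix.add_vecMul, Matrix.sum_vecMul,
    Matrix.vecMul_vecMul, add_assoc]

/-- The layer preceded by a tuple-wise linear map. -/
def EquivLayer.preLinear {k l d e f : ℕ} (L : EquivLayer k l e f) (W : Matrix (Fin d) (Fin e) ℝ) :
    EquivLayer k l d f where
  w μ := W * L.w μ
  b := L.b

theorem EquivLayer.preLinear_eval {k l d e f n : ℕ} (L : EquivLayer k l e f)
    (W : Matrix (Fin d) (Fin e) ℝ) (X : TupleTensor n k d) :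
    (L.preLinear W).eval X = L.eval (fun i => X i ᵥ* W) := by
  funext i
  simp only [EquivLayer.eval_apply, EquivLayer.preLinear, Matrix.vecMul_vecMul]

open Classical in
/-- The layer `X ↦ (X_i W₁ + ∑_j X_j W₂ + b)_i`. -/
def aggregationLayer (k : ℕ) {d e : ℕ} (W₁ W₂ : Matrix (Fin d) (Fin e) ℝ) (b : Fin e → ℝ) :
    EquivLayer k k d e where
  -- The patterns tying each output position to the same input position together single out `j = i`;
  -- equal weight on all patterns gives the unrestricted sum over `j`.
  w μ := (if ∀ r, μ (Sum.inl r) (Sum.inr r) then W₁ else 0) + W₂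
  b _ := b

theorem aggregationLayer_eval {k d e n : ℕ} (W₁ W₂ : Matrix (Fin d) (Fin e) ℝ) (b : Fin e → ℝ)
    (X : TupleTensor n k d) (i : Fin k → Fin n) :
    (aggregationLayer k W₁ W₂ b).eval X i = X i ᵥ* W₁ + ∑ j, X j ᵥ* W₂ + b := by
  classical
  have h : ∀ j : Fin k → Fin n,
      (∀ r, Setoid.ker (Sum.elim i j) (Sum.inl r) (Sum.inr r)) ↔ i = j := fun j => by
    simp [Setoid.ker_def, funext_iff]
  simp only [EquivLayer.eval_apply, aggregationLayer, h, Matrix.vecMul_add,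
    Finset.sum_add_distrib]
  congr 2
  rw [Finset.sum_eq_single i]
  · simp
  · intro j _ hj
    simp [hj.symm]
  · simp

/-! ### Trunks -/

/-- The trunk preceded by a tuple-wise linear map. -/
def IGNTrunk.preLinear {k d e f : ℕ} (W : Matrix (Fin d) (Fin e) ℝ) :
    IGNTrunk k e f → IGNTrunk k d f
  | .last L => .last (L.preLinear W)
  | .layer L N => .layer (L.preLinear W) N

theorem IGNTrunk.preLinear_eval (σ : ℝ → ℝ) {k d e f n : ℕ} (W : Matrix (Fin d) (Fin e) ℝ)
    (N : IGNTrunk k e f) (X : TupleTensor n k d) :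
    (N.preLinear W).eval σ X = N.eval σ (fun i => X i ᵥ* W) := by
  cases N <;> simp only [IGNTrunk.preLinear, IGNTrunk.eval, EquivLayer.preLinear_eval]

/-- Two trunks joined by a tuple-wise perceptron with one hidden layer. -/
def IGNTrunk.join {k d e e' f m : ℕ} : IGNTrunk k d e → Matrix (Fin e) (Fin m) ℝ →
    (Fin m → ℝ) → Matrix (Fin m) (Fin e') ℝ → IGNTrunk k e' f → IGNTrunk k d f
  | .last L, W, b, W', N' => .layer (L.postAffine W b) (N'.preLinear W')
  | .layer L N, W, b, W', N' => .layer L (N.join W b W' N')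

theorem IGNTrunk.join_eval (σ : ℝ → ℝ) {k d e e' f n : ℕ} {m : ℕ} (W : Matrix (Fin e) (Fin m) ℝ)
    (b : Fin m → ℝ) (W' : Matrix (Fin m) (Fin e') ℝ) (N' : IGNTrunk k e' f)
    (N : IGNTrunk k d e) (X : TupleTensor n k d) :
    (N.join W b W' N').eval σ X =
      N'.eval σ (fun i => (fun c => σ ((N.eval σ X i ᵥ* W + b) c)) ᵥ* W') := by
  induction N with
  | last L =>
    simp only [IGNTrunk.join, IGNTrunk.eval, IGNTrunk.preLinear_eval, EquivLayer.postAffine_eval]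
  | layer L N ih => simp only [IGNTrunk.join, IGNTrunk.eval, ih]

/-! ### Families of maps approximated by trunks -/

/-- Continuous maps between tuple tensors, one for each number of nodes; their product carries
the topology of uniform convergence on compact sets for each number of nodes. -/
abbrev TensorFamily (k d e : ℕ) : Type := (n : ℕ) → C(TupleTensor n k d, TupleTensor n k e)

/-- The families computed by trunks. -/
def trunkFamilies (σ : ℝ → ℝ) (k d e : ℕ) : Set (TensorFamily k d e) :=
  {F | ∃ N : IGNTrunk k d e, ∀ n X, F n X = N.eval σ X}

/-- A map applied to the feature of each tuple. -/
def tuplewise (n k : ℕ) {d e : ℕ} (h : C(Fin d → ℝ, Fin e → ℝ)) :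
    C(TupleTensor n k d, TupleTensor n k e) :=
  ⟨fun X i => h (X i), by fun_prop⟩

theorem continuous_tuplewise (n k d e : ℕ) :
    Continuous (tuplewise n k : C(Fin d → ℝ, Fin e → ℝ) → _) := by
  refine ContinuousMap.continuous_of_continuous_uncurry _ ?_
  refine continuous_pi fun i => ?_
  change Continuous fun p : C(Fin d → ℝ, Fin e → ℝ) × TupleTensor n k d => p.1 (p.2 i)
  fun_prop

/-- The maps computed by perceptrons with one hidden layer and no output bias. -/
def hiddenLayerMaps (σ : ℝ → ℝ) (d e : ℕ) : Set C(Fin d → ℝ, Fin e → ℝ) :=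
  {h | ∃ (m : ℕ) (W : Matrix (Fin d) (Fin m) ℝ) (b : Fin m → ℝ) (W' : Matrix (Fin m) (Fin e) ℝ),
    ∀ x, h x = (fun c => σ ((x ᵥ* W + b) c)) ᵥ* W'}

/-- A family of functions of one variable, applied to the entries of a vector. -/
def entrywise {e : ℕ} (g : Fin e → C(ℝ, ℝ)) : C(Fin e → ℝ, Fin e → ℝ) :=
  ⟨fun x c => g c (x c), by fun_prop⟩

theorem continuous_entrywise (e : ℕ) : Continuous (entrywise : (Fin e → C(ℝ, ℝ)) → _) := by
  refine ContinuousMap.continuous_of_continuous_uncurry _ ?_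
  refine continuous_pi fun c => ?_
  change Continuous fun p : (Fin e → C(ℝ, ℝ)) × (Fin e → ℝ) => p.1 c (p.2 c)
  fun_prop

theorem entrywise_mem_closure_hiddenLayerMaps (σ : C(ℝ, ℝ)) {e : ℕ} (g : Fin e → C(ℝ, ℝ))
    (hg : ∀ c, g c ∈ ridgeSpan σ) : entrywise g ∈ closure (hiddenLayerMaps σ e e) := by
  classical
  set v : ℝ × ℝ → C(ℝ, ℝ) := fun p => σ.comp ⟨fun x => p.1 * x + p.2, by fun_prop⟩ with hv
  have hcl : g ∈ closure (Set.univ.pi fun _ : Fin e =>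
      (Submodule.span ℝ (Set.range v) : Set C(ℝ, ℝ))) := by
    rw [closure_pi_set]
    exact fun c _ => hg c
  refine map_mem_closure (continuous_entrywise e) hcl fun g hg => ?_
  have hl : ∀ c, ∃ l : ℝ × ℝ →₀ ℝ, Finsupp.linearCombination ℝ v l = g c := fun c =>
    (Finsupp.mem_span_range_iff_exists_finsupp).1 (hg c trivial) |>.imp fun l hl => by
      rw [Finsupp.linearCombination_apply]; exact hl
  choose l hl using hl
  -- Hidden units are pairs of a coordinate and a slope–offset pair from the union `T` of all
  -- supports; coefficients outside a support are zero.
  set T : Finset (ℝ × ℝ) := Finset.univ.biUnion fun c => (l c).support with hT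
  let E : Fin e × T ≃ Fin (Fintype.card (Fin e × T)) := Fintype.equivFin _
  refine ⟨_, Matrix.of fun c s => if c = (E.symm s).1 then (E.symm s).2.1.1 else 0,
    fun s => (E.symm s).2.1.2,
    Matrix.of fun s c => if c = (E.symm s).1 then l c (E.symm s).2 else 0, fun x => ?_⟩
  funext c
  have h1 : ∀ s, (x ᵥ* (Matrix.of fun c s => if c = (E.symm s).1 then (E.symm s).2.1.1 else 0)) s
      = (E.symm s).2.1.1 * x (E.symm s).1 := fun s => by
    simp [Matrix.vecMul, dotProduct, mul_comm]
  have h2 : g c (x c) = ∑ p ∈ T, l c p * σ (p.1 * x c + p.2) := by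
    rw [← hl c, Finsupp.linearCombination_apply, Finsupp.sum_of_support_subset (s := T)]
    · simp [ContinuousMap.sum_apply, hv]
    · exact Finset.subset_biUnion_of_mem (fun c => (l c).support) (Finset.mem_univ c)
    · simp
  simp only [entrywise, ContinuousMap.coe_mk, h2]
  simp only [Pi.add_apply, h1]
  simp only [Matrix.vecMul, dotProduct, Matrix.of_apply]
  rw [← E.sum_comp]
  simp only [Equiv.symm_apply_apply]
  rw [Fintype.sum_prod_type, Finset.sum_eq_single c]
  · simp only [if_true]
    rw [← Finset.sum_coe_sort T]
    exact Finset.sum_congr rfl fun p _ => by ring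
  · intro c' _ hc'
    simp [hc'.symm]
  · simp

theorem id_mem_closure_hiddenLayerMaps {σ : C(ℝ, ℝ)} (hσ : ¬ ∃ a b : ℝ, ∀ x, σ x = a * x + b)
    (e : ℕ) : ContinuousMap.id _ ∈ closure (hiddenLayerMaps σ e e) :=
  entrywise_mem_closure_hiddenLayerMaps σ (fun _ => ContinuousMap.id ℝ)
    fun _ => id_mem_ridgeSpan hσ

/-- The composition of two families. -/
def TensorFamily.comp {k d e f : ℕ} (G : TensorFamily k e f) (F : TensorFamily k d e) :
    TensorFamily k d f := fun n => (G n).comp (F n)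

/-- Adjacent linear layers of two trunks cannot simply be merged: the product of two equivariant
layers has weights that depend on `n`. Instead, a hidden layer approximating the identity is
inserted between them, so the composite is a limit of trunks. -/
theorem comp_mem_closure_trunkFamilies {σ : C(ℝ, ℝ)} (hσ : ¬ ∃ a b : ℝ, ∀ x, σ x = a * x + b)
    {k d e f : ℕ} {G : TensorFamily k e f} {F : TensorFamily k d e}
    (hG : G ∈ closure (trunkFamilies σ k e f)) (hF : F ∈ closure (trunkFamilies σ k d e)) :
    G.comp F ∈ closure (trunkFamilies σ k d f) := by
  have hcont : Continuous fun p : TensorFamily k e f × TensorFamily k d e => p.1.comp p.2 :=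
    continuous_pi fun n => ((continuous_apply n).comp continuous_fst).compCM
      ((continuous_apply n).comp continuous_snd)
  rw [← closure_closure (s := trunkFamilies σ k d f)]
  refine map_mem_closure₂ (f := fun G F => TensorFamily.comp G F) hcont hG hF ?_
  rintro G ⟨N', hN'⟩ F ⟨N, hN⟩
  have hc : Continuous fun h : C(Fin e → ℝ, Fin e → ℝ) =>
      (fun n => (G n).comp ((tuplewise n k h).comp (F n)) : TensorFamily k d f) :=
    continuous_pi fun n => ((G n).continuous_postcomp.comp
      ((F n).continuous_precomp)).comp (continuous_tuplewise n k e e)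
  refine map_mem_closure (f := fun h : C(Fin e → ℝ, Fin e → ℝ) =>
      (fun n => (G n).comp ((tuplewise n k h).comp (F n)) : TensorFamily k d f)) hc
    (id_mem_closure_hiddenLayerMaps hσ e) ?_
  rintro h ⟨m, W, b, W', hh⟩
  refine ⟨N.join W b W' N', fun n X => ?_⟩
  rw [IGNTrunk.join_eval]
  simp only [ContinuousMap.comp_apply, hN', hN, tuplewise, ContinuousMap.coe_mk, hh]

/-- The family `F` is a limit of trunks, uniformly on compact sets of tensors. -/
def TrunkApprox (σ : ℝ → ℝ) {k d e : ℕ} (F : (n : ℕ) → TupleTensor n k d → TupleTensor n k e) :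
    Prop :=
  ∃ G ∈ closure (trunkFamilies σ k d e), ∀ n X, G n X = F n X

theorem TrunkApprox.comp {σ : C(ℝ, ℝ)} (hσ : ¬ ∃ a b : ℝ, ∀ x, σ x = a * x + b)
    {k d e f : ℕ} {G : (n : ℕ) → TupleTensor n k e → TupleTensor n k f}
    {F : (n : ℕ) → TupleTensor n k d → TupleTensor n k e}
    (hG : TrunkApprox σ G) (hF : TrunkApprox σ F) :
    TrunkApprox σ fun n X => G n (F n X) := by
  obtain ⟨G', hG', hGG⟩ := hG
  obtain ⟨F', hF', hFF⟩ := hF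
  exact ⟨_, comp_mem_closure_trunkFamilies hσ hG' hF', fun n X => by
    simp only [TensorFamily.comp, ContinuousMap.comp_apply, hGG, hFF]⟩

theorem trunkApprox_layer (σ : ℝ → ℝ) {k d e : ℕ} (L : EquivLayer k k d e) :
    TrunkApprox σ fun _ X => L.eval X :=
  ⟨fun _ => ⟨L.eval, L.continuous_eval⟩, subset_closure ⟨.last L, fun _ _ => rfl⟩,
    fun _ _ => rfl⟩

theorem isClosed_setOf_tuplewise_trunkApprox (σ : ℝ → ℝ) (k d e : ℕ) :
    IsClosed {f : C(Fin d → ℝ, Fin e → ℝ) |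
      TrunkApprox σ (k := k) fun _ X i => f (X i)} := by
  have : {f : C(Fin d → ℝ, Fin e → ℝ) | TrunkApprox σ (k := k) fun _ X i => f (X i)} =
      (fun f => (fun n => tuplewise n k f : TensorFamily k d e)) ⁻¹'
        closure (trunkFamilies σ k d e) := by
    ext f
    constructor
    · rintro ⟨G, hG, h⟩
      have : G = fun n => tuplewise n k f := by
        funext n
        ext1 X
        exact h n X
      rwa [this] at hG
    · exact fun h => ⟨_, h, fun _ _ => rfl⟩
  rw [this]
  exact isClosed_closure.preimage (continuous_pi fun n => continuous_tuplewise n k d e)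

theorem trunkApprox_hiddenLayer (σ : ℝ → ℝ) {k d e : ℕ} {h : C(Fin d → ℝ, Fin e → ℝ)}
    (hh : h ∈ hiddenLayerMaps σ d e) : TrunkApprox σ (k := k) fun _ X i => h (X i) := by
  obtain ⟨m, W, b, W', hh⟩ := hh
  refine ⟨fun n => tuplewise n k h, subset_closure ⟨.layer (aggregationLayer k W 0 b)
    (.last (aggregationLayer k W' 0 0)), fun n X => ?_⟩, fun _ _ => rfl⟩
  funext i
  simp [tuplewise, IGNTrunk.eval, aggregationLayer_eval, hh]

theorem trunkApprox_entrywise {σ : C(ℝ, ℝ)} {k e : ℕ} (g : Fin e → C(ℝ, ℝ))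
    (hg : ∀ c, g c ∈ ridgeSpan σ) : TrunkApprox σ (k := k) fun _ X i => entrywise g (X i) :=
  (isClosed_setOf_tuplewise_trunkApprox σ k e e).closure_subset_iff.2
    (fun _ hh => trunkApprox_hiddenLayer σ hh) (entrywise_mem_closure_hiddenLayerMaps σ g hg)

/-! ### Tuple-wise continuous maps -/

theorem mem_closure_iff_compact {X Y : Type*} [TopologicalSpace X] [PseudoMetricSpace Y]
    {A : Set C(X, Y)} {f : C(X, Y)} :
    f ∈ closure A ↔ ∀ K : Set X, IsCompact K → ∀ ε > 0, ∃ g ∈ A, ∀ x ∈ K, dist (f x) (g x) < ε := by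
  rw [mem_closure_iff_nhds_basis (nhds_basis_uniformity'
    (Metric.uniformity_basis_dist.compactConvergenceUniformity (α := X)))]
  constructor
  · intro h K hK ε hε
    obtain ⟨g, hg, hd⟩ := h (K, ε) ⟨hK, hε⟩
    exact ⟨g, hg, hd⟩
  · rintro h ⟨K, ε⟩ ⟨hK, hε⟩
    exact h K hK ε hε

theorem trunkApprox_linear_aggregation (σ : ℝ → ℝ) {k d e : ℕ}
    (T₁ T₂ : (Fin d → ℝ) →ₗ[ℝ] (Fin e → ℝ)) (b : Fin e → ℝ) :
    TrunkApprox σ (k := k) fun _ X i => T₁ (X i) + ∑ j, T₂ (X j) + b := by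
  obtain ⟨G, hG, h⟩ := trunkApprox_layer σ (aggregationLayer k (LinearMap.toMatrix' T₁)ᵀ
    (LinearMap.toMatrix' T₂)ᵀ b)
  refine ⟨G, hG, fun n X => ?_⟩
  rw [h]
  funext i
  simp [aggregationLayer_eval, Matrix.vecMul_transpose]

/-- The map `f`, applied to the feature of each tuple, is a limit of trunks of order `k`. -/
def TuplewiseApprox (σ : ℝ → ℝ) (k : ℕ) {d e : ℕ} (f : (Fin d → ℝ) → Fin e → ℝ) : Prop :=
  TrunkApprox σ (k := k) fun _ X i => f (X i)

theorem TuplewiseApprox.comp {σ : C(ℝ, ℝ)} (hσ : ¬ ∃ a b : ℝ, ∀ x, σ x = a * x + b)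
    {k d e f : ℕ} {h : (Fin e → ℝ) → Fin f → ℝ} {g : (Fin d → ℝ) → Fin e → ℝ}
    (hh : TuplewiseApprox σ k h) (hg : TuplewiseApprox σ k g) :
    TuplewiseApprox σ k fun x => h (g x) :=
  TrunkApprox.comp hσ hh hg

theorem tuplewiseApprox_affine (σ : ℝ → ℝ) {k d e : ℕ} (T : (Fin d → ℝ) →ₗ[ℝ] (Fin e → ℝ))
    (b : Fin e → ℝ) : TuplewiseApprox σ k fun x => T x + b := by
  simpa [TuplewiseApprox] using trunkApprox_linear_aggregation σ (k := k) T 0 b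

theorem tuplewiseApprox_linear (σ : ℝ → ℝ) {k d e : ℕ} (T : (Fin d → ℝ) →ₗ[ℝ] (Fin e → ℝ)) :
    TuplewiseApprox σ k fun x => T x := by
  simpa using tuplewiseApprox_affine σ (k := k) T 0

/-- The linear map that prepends a linear functional to a linear map. -/
def consLinear {d e : ℕ} (l : (Fin d → ℝ) →ₗ[ℝ] ℝ) (T : (Fin d → ℝ) →ₗ[ℝ] (Fin e → ℝ)) :
    (Fin d → ℝ) →ₗ[ℝ] (Fin (e + 1) → ℝ) :=
  LinearMap.pi (Fin.cons l fun c => LinearMap.proj c ∘ₗ T)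

theorem consLinear_apply {d e : ℕ} (l : (Fin d → ℝ) →ₗ[ℝ] ℝ)
    (T : (Fin d → ℝ) →ₗ[ℝ] (Fin e → ℝ)) (x : Fin d → ℝ) :
    consLinear l T x = Fin.cons (l x) (T x) := by
  funext c
  refine Fin.cases ?_ (fun c => ?_) c <;> simp [consLinear]

/-- Dropping the first coordinate. -/
def tailLinear (e : ℕ) : (Fin (e + 1) → ℝ) →ₗ[ℝ] (Fin e → ℝ) := LinearMap.funLeft ℝ ℝ Fin.succ

theorem tailLinear_cons {e : ℕ} (a : ℝ) (y : Fin e → ℝ) :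
    tailLinear e (Fin.cons a y : Fin (e + 1) → ℝ) = y := by
  funext c
  simp [tailLinear, LinearMap.funLeft_apply]

/-- The scalar function `p` can be adjoined to the features of every limit of trunks that retains
its input. -/
def Adjoinable (σ : ℝ → ℝ) (k : ℕ) {d : ℕ} (p : (Fin d → ℝ) → ℝ) : Prop :=
  ∀ (e : ℕ) (g : C(Fin d → ℝ, Fin e → ℝ)),
    (∃ T : (Fin e → ℝ) →ₗ[ℝ] (Fin d → ℝ), ∀ x, T (g x) = x) → TuplewiseApprox σ k g →
    TuplewiseApprox σ k fun x => (Fin.cons (p x) (g x) : Fin (e + 1) → ℝ)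

theorem adjoinable_coordinate {σ : C(ℝ, ℝ)} (hσ : ¬ ∃ a b : ℝ, ∀ x, σ x = a * x + b) (k : ℕ)
    {d : ℕ} (c : Fin d) : Adjoinable σ k fun x => x c := by
  rintro e g ⟨T, hT⟩ hg
  have h := (tuplewiseApprox_linear σ (consLinear (LinearMap.proj c ∘ₗ T) LinearMap.id)).comp hσ hg
  simpa [consLinear_apply, hT] using h

theorem adjoinable_const {σ : C(ℝ, ℝ)} (hσ : ¬ ∃ a b : ℝ, ∀ x, σ x = a * x + b) (k d : ℕ)
    (r : ℝ) : Adjoinable σ k fun _ : Fin d → ℝ => r := by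
  rintro e g - hg
  have h := (tuplewiseApprox_affine σ (consLinear 0 LinearMap.id) (Fin.cons r 0)).comp hσ hg
  convert h using 2 with x
  rw [consLinear_apply]
  funext c
  refine Fin.cases ?_ (fun c => ?_) c <;> simp

/-- After `p` is adjoined the input can still be recovered by dropping the new coordinate, so `q`
can be adjoined next. -/
theorem Adjoinable.pair {σ : C(ℝ, ℝ)} {k d : ℕ}
    {p q : C(Fin d → ℝ, ℝ)} (hp : Adjoinable σ k p) (hq : Adjoinable σ k q) {e : ℕ}
    (g : C(Fin d → ℝ, Fin e → ℝ))
    (hgT : ∃ T : (Fin e → ℝ) →ₗ[ℝ] (Fin d → ℝ), ∀ x, T (g x) = x)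
    (hg : TuplewiseApprox σ k g) :
    TuplewiseApprox σ k fun x =>
      (Fin.cons (q x) (Fin.cons (p x) (g x) : Fin (e + 1) → ℝ) : Fin (e + 1 + 1) → ℝ) := by
  have h1 := hp e g hgT hg
  obtain ⟨T, hT⟩ := hgT
  refine hq (e + 1) ⟨fun x => Fin.cons (p x) (g x), ?_⟩ ⟨T ∘ₗ tailLinear e, fun x => ?_⟩ h1
  · exact p.continuous.finCons g.continuous
  · simp [tailLinear_cons, hT]

theorem Adjoinable.add {σ : C(ℝ, ℝ)} (hσ : ¬ ∃ a b : ℝ, ∀ x, σ x = a * x + b) {k d : ℕ}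
    {p q : C(Fin d → ℝ, ℝ)} (hp : Adjoinable σ k p) (hq : Adjoinable σ k q) :
    Adjoinable σ k (p + q : C(Fin d → ℝ, ℝ)) := by
  intro e g hgT hg
  have h := (tuplewiseApprox_linear σ (consLinear
    (LinearMap.proj (R := ℝ) (φ := fun _ => ℝ) 1 + LinearMap.proj 0)
    (tailLinear e ∘ₗ tailLinear (e + 1)))).comp hσ (hp.pair hq g hgT hg)
  simpa [consLinear_apply, tailLinear_cons] using h

/-- `4 p q = (p + q) ^ 2 - (p - q) ^ 2`: one entrywise layer squares the first two coordinates and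
keeps the others. -/
theorem Adjoinable.mul {σ : C(ℝ, ℝ)} (hσ : ¬ ∃ a b : ℝ, ∀ x, σ x = a * x + b) {k d : ℕ}
    {p q : C(Fin d → ℝ, ℝ)} (hp : Adjoinable σ k p) (hq : Adjoinable σ k q) :
    Adjoinable σ k (p * q : C(Fin d → ℝ, ℝ)) := by
  intro e g hgT hg
  let s : C(ℝ, ℝ) := ⟨fun x => x ^ 2, by fun_prop⟩
  let S : Fin (e + 1 + 1) → C(ℝ, ℝ) :=
    Fin.cons s (Fin.cons s fun _ => ContinuousMap.id ℝ : Fin (e + 1) → C(ℝ, ℝ))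
  have hS : ∀ c, S c ∈ ridgeSpan σ := by
    refine Fin.cases (sq_mem_ridgeSpan hσ) (Fin.cases (sq_mem_ridgeSpan hσ) fun _ => ?_)
    exact id_mem_ridgeSpan hσ
  have h1 := (tuplewiseApprox_linear σ (consLinear
    (LinearMap.proj (R := ℝ) (φ := fun _ => ℝ) 1 + LinearMap.proj 0)
    (consLinear (LinearMap.proj (R := ℝ) (φ := fun _ => ℝ) 1 - LinearMap.proj 0)
      (tailLinear e ∘ₗ tailLinear (e + 1))))).comp hσ (hp.pair hq g hgT hg)
  have h2 : TuplewiseApprox σ k (entrywise S) := trunkApprox_entrywise S hS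
  have h3 := (tuplewiseApprox_linear σ (consLinear
    ((4⁻¹ : ℝ) • (LinearMap.proj (R := ℝ) (φ := fun _ => ℝ) 0 - LinearMap.proj 1))
    (tailLinear e ∘ₗ tailLinear (e + 1)))).comp hσ (h2.comp hσ h1)
  convert h3 using 2 with x
  simp only [consLinear_apply]
  funext c
  refine Fin.cases ?_ (fun c => ?_) c
  · simp [entrywise, S, s, tailLinear_cons]
    ring
  · simp [entrywise, S, tailLinear, LinearMap.funLeft_apply]

theorem isClosed_setOf_adjoinable (σ : ℝ → ℝ) (k d : ℕ) :
    IsClosed {p : C(Fin d → ℝ, ℝ) | Adjoinable σ k p} := by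
  simp only [Adjoinable, Set.ofPred_forall]
  refine isClosed_iInter fun e => isClosed_iInter fun g => isClosed_iInter fun _ =>
    isClosed_iInter fun _ => ?_
  let Φ : C(Fin d → ℝ, ℝ) → C(Fin d → ℝ, Fin (e + 1) → ℝ) := fun p =>
    ⟨fun x => Fin.cons (p x) (g x), p.continuous.finCons g.continuous⟩
  have hΦ : Continuous Φ := by
    refine ContinuousMap.continuous_of_continuous_uncurry _ ?_
    change Continuous fun q : C(Fin d → ℝ, ℝ) × (Fin d → ℝ) =>
      (Fin.cons (q.1 q.2) (g q.2) : Fin (e + 1) → ℝ)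
    exact Continuous.finCons (by fun_prop) (by fun_prop)
  exact (isClosed_setOf_tuplewise_trunkApprox σ k d (e + 1)).preimage hΦ

/-- The algebra of adjoinable functions. -/
def adjoinableSubalgebra {σ : C(ℝ, ℝ)} (hσ : ¬ ∃ a b : ℝ, ∀ x, σ x = a * x + b) (k d : ℕ) :
    Subalgebra ℝ C(Fin d → ℝ, ℝ) where
  carrier := {p | Adjoinable σ k p}
  mul_mem' hp hq := Adjoinable.mul hσ hp hq
  add_mem' hp hq := Adjoinable.add hσ hp hq
  algebraMap_mem' r := adjoinable_const hσ k d r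

/-- Adjoinable functions form a closed subalgebra that contains the coordinates, so
Stone–Weierstrass on compact sets applies. -/
theorem adjoinable_of_continuous {σ : C(ℝ, ℝ)} (hσ : ¬ ∃ a b : ℝ, ∀ x, σ x = a * x + b) (k : ℕ)
    {d : ℕ} (p : C(Fin d → ℝ, ℝ)) : Adjoinable σ k p := by
  have hsep : (adjoinableSubalgebra hσ k d).SeparatesPoints := by
    intro x y hxy
    obtain ⟨c, hc⟩ := Function.ne_iff.1 hxy
    exact ⟨_, ⟨⟨fun x => x c, by fun_prop⟩, adjoinable_coordinate hσ k c, rfl⟩, hc⟩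
  have hp : p ∈ closure {p : C(Fin d → ℝ, ℝ) | Adjoinable σ k p} := by
    refine mem_closure_iff_compact.2 fun K hK ε hε => ?_
    obtain ⟨g, hg, hd⟩ :=
      ContinuousMap.exists_mem_subalgebra_near_continuous_of_isCompact_of_separatesPoints
        hsep p hK hε
    exact ⟨g, hg, fun x hx => by rw [dist_comm, dist_eq_norm]; exact hd x hx⟩
  rwa [(isClosed_setOf_adjoinable σ k d).closure_eq] at hp

theorem tuplewiseApprox_of_continuous {σ : C(ℝ, ℝ)}
    (hσ : ¬ ∃ a b : ℝ, ∀ x, σ x = a * x + b) (k : ℕ) {d e : ℕ} {f : (Fin d → ℝ) → Fin e → ℝ}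
    (hf : Continuous f) : TuplewiseApprox σ k f := by
  -- The components of `f` are adjoined one at a time to a feature that retains the input; a linear
  -- map finally reads them off.
  have key : ∃ (m : ℕ) (g : C(Fin d → ℝ, Fin m → ℝ)), TuplewiseApprox σ k g ∧
      (∃ T : (Fin m → ℝ) →ₗ[ℝ] (Fin d → ℝ), ∀ x, T (g x) = x) ∧
      ∃ T : (Fin m → ℝ) →ₗ[ℝ] (Fin e → ℝ), ∀ x, T (g x) = f x := by
    induction e with
    | zero =>
      exact ⟨d, ContinuousMap.id _, tuplewiseApprox_linear σ LinearMap.id,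
        ⟨LinearMap.id, fun _ => rfl⟩, ⟨0, fun x => Subsingleton.elim _ _⟩⟩
    | succ e ih =>
      obtain ⟨m, g, hg, ⟨T, hT⟩, T', hT'⟩ := ih (f := fun x c => f x c.succ) (by fun_prop)
      let p : C(Fin d → ℝ, ℝ) := ⟨fun x => f x 0, by fun_prop⟩
      refine ⟨m + 1, ⟨fun x => Fin.cons (p x) (g x), p.continuous.finCons g.continuous⟩,
        adjoinable_of_continuous hσ k p m g ⟨T, hT⟩ hg, ⟨T ∘ₗ tailLinear m, fun x => ?_⟩,
        ⟨consLinear (LinearMap.proj 0) (T' ∘ₗ tailLinear m), fun x => ?_⟩⟩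
      · simp [tailLinear_cons, hT]
      · simp only [consLinear_apply, ContinuousMap.coe_mk, LinearMap.comp_apply, tailLinear_cons,
          hT', LinearMap.proj_apply, Fin.cons_zero, p]
        funext c
        refine Fin.cases ?_ (fun c => ?_) c <;> simp
  obtain ⟨m, g, hg, -, T, hT⟩ := key
  have h := (tuplewiseApprox_linear σ T).comp hσ hg
  simpa only [hT] using h

/-- Tuple-wise continuous maps of a feature and the sum of continuously encoded features. -/
theorem trunkApprox_aggregate {σ : C(ℝ, ℝ)} (hσ : ¬ ∃ a b : ℝ, ∀ x, σ x = a * x + b) {k d e : ℕ}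
    {E : Type*} [NormedAddCommGroup E] [NormedSpace ℝ E] [FiniteDimensional ℝ E]
    {f₁ : (Fin d → ℝ) → E} (hf₁ : Continuous f₁) {f₂ : (Fin d → ℝ) × E → Fin e → ℝ}
    (hf₂ : Continuous f₂) :
    TrunkApprox σ (k := k) fun _ X i => f₂ (X i, ∑ j, f₁ (X j)) := by
  set D := Module.finrank ℝ E
  let φ : E ≃L[ℝ] (Fin D → ℝ) := (Module.finBasis ℝ E).equivFunL
  let P₁ : (Fin (d + D) → ℝ) →ₗ[ℝ] (Fin d → ℝ) := LinearMap.funLeft ℝ ℝ (Fin.castAdd D)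
  let P₂ : (Fin (d + D) → ℝ) →ₗ[ℝ] (Fin D → ℝ) := LinearMap.funLeft ℝ ℝ (Fin.natAdd d)
  let I₁ : (Fin d → ℝ) →ₗ[ℝ] (Fin (d + D) → ℝ) :=
    LinearMap.pi (Fin.append (fun c => LinearMap.proj c) fun _ => 0)
  let I₂ : (Fin D → ℝ) →ₗ[ℝ] (Fin (d + D) → ℝ) :=
    LinearMap.pi (Fin.append (fun _ => 0) fun c => LinearMap.proj c)
  have h11 : ∀ x, P₁ (I₁ x) = x := fun x => by ext c; simp [P₁, I₁, LinearMap.funLeft_apply]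
  have h12 : ∀ x, P₁ (I₂ x) = 0 := fun x => by ext c; simp [P₁, I₂, LinearMap.funLeft_apply]
  have h21 : ∀ x, P₂ (I₁ x) = 0 := fun x => by ext c; simp [P₂, I₁, LinearMap.funLeft_apply]
  have h22 : ∀ x, P₂ (I₂ x) = x := fun x => by ext c; simp [P₂, I₂, LinearMap.funLeft_apply]
  -- Encode, aggregate, decode: `ha` stores `x` and `f₁ x` in separate blocks, `hb` keeps the first
  -- block and sums the second over all tuples, `hc` applies `f₂`.
  have ha : TuplewiseApprox σ k fun x => I₁ x + I₂ (φ (f₁ x)) :=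
    tuplewiseApprox_of_continuous hσ k
      (I₁.continuous_of_finiteDimensional.add
        (I₂.continuous_of_finiteDimensional.comp (φ.continuous.comp hf₁)))
  have hb := trunkApprox_linear_aggregation σ (k := k) (I₁ ∘ₗ P₁) (I₂ ∘ₗ P₂) 0
  have hc : TuplewiseApprox σ k fun y => f₂ (P₁ y, φ.symm (P₂ y)) :=
    tuplewiseApprox_of_continuous hσ k
      (hf₂.comp (P₁.continuous_of_finiteDimensional.prodMk
        (φ.symm.continuous.comp P₂.continuous_of_finiteDimensional)))
  have h := TrunkApprox.comp hσ hc (TrunkApprox.comp hσ hb ha)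
  simpa [h11, h12, h21, h22] using h

/-! ### Kernelized transformers are limits of trunks -/

theorem continuous_elu : Continuous elu := by
  have h : elu = fun x => if x ≤ 0 then Real.exp x - 1 else x := by
    funext x
    by_cases hx : 0 < x
    · simp [elu, hx]
    · simp [elu, hx, not_lt.1 hx]
  rw [h]
  refine Continuous.if_le (by fun_prop) continuous_id continuous_id continuous_const ?_
  rintro x rfl
  simp

theorem elu_add_one_pos (x : ℝ) : 0 < elu x + 1 := by
  unfold elu
  split_ifs with h
  · linarith
  · simpa using Real.exp_pos x

theorem FeatureMap.continuous_eval {p m : ℕ} (φ : FeatureMap p m) : Continuous φ.eval := by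
  cases φ with
  | linearTransformer hp =>
    exact continuous_pi fun r => (continuous_elu.comp (continuous_apply r)).add continuous_const
  | performer hm ω =>
    refine continuous_pi fun r => ?_
    simp only [FeatureMap.eval, dotProduct]
    fun_prop

theorem FeatureMap.eval_pos {p m : ℕ} (φ : FeatureMap p m) (x : Fin p → ℝ) (r : Fin m) :
    0 < φ.eval x r := by
  cases φ with
  | linearTransformer hp => exact elu_add_one_pos _
  | performer hm ω => simp only [FeatureMap.eval]; positivity

theorem FeatureMap.dim_pos {p m : ℕ} (φ : FeatureMap p m) : 0 < m := by
  cases φ <;> assumption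

namespace KernelHead

variable {d v : ℕ} (A : KernelHead d v)

/-- The query vector of a feature. -/
def query (x : Fin d → ℝ) : Fin A.m → ℝ := A.φ.eval (x ᵥ* A.Q + A.bQ)

/-- The key vector of a feature, and its tensor product with the value vector. -/
def encode (x : Fin d → ℝ) : (Fin A.m → ℝ) × (Fin A.m → Fin v → ℝ) :=
  (A.φ.eval (x ᵥ* A.K + A.bK),
    fun r c => A.φ.eval (x ᵥ* A.K + A.bK) r * (x ᵥ* A.V + A.bV) c)

/-- The normalization of the attention of a query to aggregated keys. -/
def normalizer (x : Fin d → ℝ) (s : (Fin A.m → ℝ) × (Fin A.m → Fin v → ℝ)) : ℝ :=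
  ∑ r, A.query x r * s.1 r

/-- The output for a query and aggregated keys and values, with normalization at least `t`. -/
def readout (t : ℝ) (x : Fin d → ℝ) (s : (Fin A.m → ℝ) × (Fin A.m → Fin v → ℝ)) : Fin v → ℝ :=
  (max t (A.normalizer x s))⁻¹ • fun c => ∑ r, A.query x r * s.2 r c

theorem continuous_query : Continuous A.query :=
  A.φ.continuous_eval.comp
    ((Continuous.matrix_vecMul continuous_id continuous_const).add continuous_const)

theorem continuous_encode : Continuous A.encode := by
  have hK : Continuous fun x : Fin d → ℝ => A.φ.eval (x ᵥ* A.K + A.bK) :=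
    A.φ.continuous_eval.comp
      ((Continuous.matrix_vecMul continuous_id continuous_const).add continuous_const)
  have hV : Continuous fun x : Fin d → ℝ => x ᵥ* A.V + A.bV :=
    (Continuous.matrix_vecMul continuous_id continuous_const).add continuous_const
  refine hK.prodMk (continuous_pi fun r => continuous_pi fun c => ?_)
  exact ((continuous_apply r).comp hK).mul ((continuous_apply c).comp hV)

theorem continuous_normalizer :
    Continuous fun z : (Fin d → ℝ) × ((Fin A.m → ℝ) × (Fin A.m → Fin v → ℝ)) =>
      A.normalizer z.1 z.2 := by
  have := A.continuous_query
  unfold normalizer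
  fun_prop

theorem continuous_readout {t : ℝ} (ht : 0 < t) :
    Continuous fun z : (Fin d → ℝ) × ((Fin A.m → ℝ) × (Fin A.m → Fin v → ℝ)) =>
      A.readout t z.1 z.2 := by
  have h := A.continuous_query
  unfold readout
  refine Continuous.smul (Continuous.inv₀ (continuous_const.max A.continuous_normalizer)
    fun z => (lt_max_of_lt_left ht).ne') ?_
  fun_prop

theorem _root_.Continuous.kernelHead_readout {Z : Type*} [TopologicalSpace Z] {t : ℝ} (ht : 0 < t)
    {x : Z → Fin d → ℝ} {s : Z → (Fin A.m → ℝ) × (Fin A.m → Fin v → ℝ)} (hx : Continuous x)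
    (hs : Continuous s) : Continuous fun z => A.readout t (x z) (s z) := by
  have h : Continuous fun z => (x z, s z) := hx.prodMk hs
  exact (Continuous.comp (A.continuous_readout ht) h :)

theorem normalizer_pos {n k : ℕ} (X : TupleTensor n k d) (i : Fin k → Fin n) :
    0 < A.normalizer (X i) (∑ j, A.encode (X j)) := by
  have : Nonempty (Fin A.m) := ⟨⟨0, A.φ.dim_pos⟩⟩
  refine Finset.sum_pos (fun r _ => mul_pos (A.φ.eval_pos _ _) ?_) Finset.univ_nonempty
  simp only [Prod.fst_sum, Finset.sum_apply]
  exact Finset.sum_pos (fun j _ => A.φ.eval_pos _ _) ⟨i, Finset.mem_univ i⟩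

theorem eval_eq_readout {n k : ℕ} (X : TupleTensor n k d) (i : Fin k → Fin n) :
    A.eval X i = A.readout 0 (X i) (∑ j, A.encode (X j)) := by
  funext c
  rw [readout, max_eq_right (A.normalizer_pos X i).le]
  simp only [eval, normalizer, query, encode, Pi.smul_apply, smul_eq_mul, Matrix.vecMul,
    dotProduct, Prod.fst_sum, Prod.snd_sum, Finset.sum_apply, Matrix.sum_apply,
    Matrix.vecMulVec_apply]

end KernelHead

theorem MLP.continuous_eval {σ : ℝ → ℝ} (hσ : Continuous σ) {d e : ℕ} (M : MLP d e) :
    Continuous (M.eval σ) := by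
  induction M with
  | affine W b =>
    exact (Continuous.matrix_vecMul continuous_id continuous_const).add continuous_const
  | layer W b M ih =>
    refine ih.comp (continuous_pi fun c => hσ.comp ((continuous_apply c).comp ?_))
    exact (Continuous.matrix_vecMul continuous_id continuous_const).add continuous_const

theorem continuous_finAppend {X : Type*} [TopologicalSpace X] {d e : ℕ} {f : X → Fin d → ℝ}
    {g : X → Fin e → ℝ} (hf : Continuous f) (hg : Continuous g) :
    Continuous fun x => Fin.append (f x) (g x) := by
  refine continuous_pi fun c => ?_
  refine Fin.addCases (fun c => ?_) (fun c => ?_) c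
  · simpa [Function.comp_def] using (continuous_apply c).comp hf
  · simpa [Function.comp_def] using (continuous_apply c).comp hg

/-- A family that is eventually equal on compact sets to members of a net of limits of trunks. -/
theorem TrunkApprox.of_eventually_eq {σ : ℝ → ℝ} {k d e : ℕ} {ι : Type*} {l : Filter ι} [l.NeBot]
    {F : ι → (n : ℕ) → TupleTensor n k d → TupleTensor n k e}
    {F₀ : (n : ℕ) → TupleTensor n k d → TupleTensor n k e}
    (hF : ∀ᶠ t in l, TrunkApprox σ (F t))
    (h : ∀ n (K : Set (TupleTensor n k d)), IsCompact K → ∀ᶠ t in l, ∀ X ∈ K, F t n X = F₀ n X) :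
    TrunkApprox σ F₀ := by
  -- Near each point `F₀` agrees with a continuous member of the net.
  have hcont : ∀ n, Continuous (F₀ n) := fun n => by
    refine continuous_iff_continuousAt.2 fun X => ?_
    obtain ⟨K, hK, hX⟩ := exists_compact_mem_nhds X
    obtain ⟨t, ⟨G, -, hG⟩, ht⟩ := (hF.and (h n K hK)).exists
    refine ((G n).continuous.continuousAt (x := X)).congr ?_
    filter_upwards [hX] with Y hY
    rw [hG, ht Y hY]
  refine ⟨fun n => ⟨F₀ n, hcont n⟩, ?_, fun _ _ => rfl⟩
  classical
  let G : ι → TensorFamily k d e := fun t =>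
    if ht : TrunkApprox σ (F t) then ht.choose else fun n => ⟨F₀ n, hcont n⟩
  have hG : ∀ t, TrunkApprox σ (F t) → G t ∈ closure (trunkFamilies σ k d e) ∧
      ∀ n X, G t n X = F t n X := fun t ht => by
    simp only [G, dif_pos ht]
    exact ht.choose_spec
  refine isClosed_closure.mem_of_tendsto (f := G) (b := l) ?_ (hF.mono fun t ht => (hG t ht).1)
  refine tendsto_pi_nhds.2 fun n => ?_
  rw [ContinuousMap.tendsto_iff_forall_isCompact_tendstoUniformlyOn]
  intro K hK
  rw [Metric.tendstoUniformlyOn_iff]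
  intro ε hε
  filter_upwards [hF, h n K hK] with t ht hK X hX
  rw [(hG t ht).2, hK X hX]
  simpa using hε

theorem eventually_le_of_isCompact {X : Type*} [TopologicalSpace X] {f : X → ℝ}
    (hf : Continuous f) (hpos : ∀ x, 0 < f x) {K : Set X} (hK : IsCompact K) :
    ∀ᶠ t in 𝓝[>] (0 : ℝ), ∀ x ∈ K, t ≤ f x := by
  rcases K.eq_empty_or_nonempty with rfl | hne
  · simp
  · obtain ⟨x, -, hx⟩ := hK.exists_isMinOn hne hf.continuousOn
    filter_upwards [Ioc_mem_nhdsGT (hpos x)] with t ht y hy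
    exact ht.2.trans (hx hy)

/-- The aggregated keys and values of several heads. -/
abbrev AttentionState {d v H : ℕ} (head : Fin H → KernelHead d v) : Type :=
  (a : Fin H) → (Fin (head a).m → ℝ) × (Fin (head a).m → Fin v → ℝ)

/-- The normalizer is positive on actual tensors but not on arbitrary aggregated states, so it is
clamped below by `t > 0` to make the readout continuous everywhere. On a compact set of tensors the
clamp is inactive once `t` is small. -/
theorem trunkApprox_attention {σ : C(ℝ, ℝ)} (hσ : ¬ ∃ a b : ℝ, ∀ x, σ x = a * x + b)
    {k c d v e f H : ℕ} (head : Fin H → KernelHead d v) (O : Fin H → Matrix (Fin v) (Fin e) ℝ)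
    {p : (Fin c → ℝ) → Fin d → ℝ} (hp : Continuous p)
    {h : (Fin c → ℝ) × (Fin e → ℝ) → Fin f → ℝ} (hh : Continuous h) :
    TrunkApprox σ (k := k) fun _ X i =>
      h (X i, ∑ a, (head a).eval (fun j => p (X j)) i ᵥ* O a) := by
  let f₁ : (Fin c → ℝ) → AttentionState head := fun x a => (head a).encode (p x)
  have hf₁ : Continuous f₁ := continuous_pi fun a => (head a).continuous_encode.comp hp
  let f₂ : ℝ → (Fin c → ℝ) × AttentionState head → Fin f → ℝ := fun t z =>
    h (z.1, ∑ a, (head a).readout t (p z.1) (z.2 a) ᵥ* O a)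
  have hf₂ : ∀ t, 0 < t → Continuous (f₂ t) := fun t ht => by
    have hr : ∀ a, Continuous fun z : (Fin c → ℝ) × AttentionState head =>
        (head a).readout t (p z.1) (z.2 a) := fun a =>
      Continuous.kernelHead_readout (head a) ht (hp.comp continuous_fst)
        ((continuous_apply a).comp continuous_snd)
    have hsum : Continuous fun z : (Fin c → ℝ) × AttentionState head =>
        ∑ a, (head a).readout t (p z.1) (z.2 a) ᵥ* O a :=
      continuous_finsetSum _ fun a _ => (hr a).matrix_vecMul continuous_const
    exact hh.comp (continuous_fst.prodMk hsum)
  refine TrunkApprox.of_eventually_eq (l := 𝓝[>] (0 : ℝ))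
    (F := fun t _ X i => f₂ t (X i, ∑ j, f₁ (X j))) ?_ fun n K hK => ?_
  · filter_upwards [self_mem_nhdsWithin] with t ht
    exact trunkApprox_aggregate hσ hf₁ (hf₂ t ht)
  · have hev : ∀ᶠ t in 𝓝[>] (0 : ℝ), ∀ (a : Fin H) (i : Fin k → Fin n), ∀ X ∈ K,
        t ≤ (head a).normalizer (p (X i)) (∑ j, (head a).encode (p (X j))) := by
      refine eventually_all.2 fun a => eventually_all.2 fun i => ?_
      refine eventually_le_of_isCompact (f := fun X : TupleTensor n k c =>
        (head a).normalizer (p (X i)) (∑ j, (head a).encode (p (X j)))) ?_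
        (fun X => (head a).normalizer_pos (fun j => p (X j)) i) hK
      refine (head a).continuous_normalizer.comp
        ((hp.comp (continuous_apply i)).prodMk (continuous_finsetSum _ fun j _ => ?_))
      exact (head a).continuous_encode.comp (hp.comp (continuous_apply j))
    filter_upwards [hev] with t ht X hX
    funext i
    simp only [f₂, f₁, Finset.sum_apply]
    congr 2
    refine Finset.sum_congr rfl fun a _ => ?_
    rw [KernelHead.eval_eq_readout, KernelHead.readout, KernelHead.readout,
      max_eq_right (ht a i X hX),
      max_eq_right ((head a).normalizer_pos (fun j => p (X j)) i).le]

/-- The input map `p` and the output map `h`, which also sees the original feature, make the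
induction work: a residual connection is absorbed into `h`, and in a composition the carried feature
travels through the first network by concatenation. -/
theorem KernelTransformer.trunkApprox_eval {σ : C(ℝ, ℝ)}
    (hσ : ¬ ∃ a b : ℝ, ∀ x, σ x = a * x + b) {k d e : ℕ} (A : KernelTransformer d e) :
    ∀ {c f : ℕ} {p : (Fin c → ℝ) → Fin d → ℝ} (_ : Continuous p)
      {h : (Fin c → ℝ) × (Fin e → ℝ) → Fin f → ℝ} (_ : Continuous h),
      TrunkApprox σ (k := k) fun _ X i => h (X i, A.eval σ (fun j => p (X j)) i) := by
  induction A with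
  | attn H head O => exact fun hp _ hh => trunkApprox_attention hσ head O hp hh
  | mlp M =>
    intro c f p hp h hh
    exact tuplewiseApprox_of_continuous hσ k (f := fun x => h (x, M.eval σ (p x)))
      (hh.comp (continuous_id.prodMk ((M.continuous_eval σ.continuous).comp hp)))
  | res A ih =>
    intro c f p hp h hh
    exact ih hp (h := fun z => h (z.1, p z.1 + z.2)) (by fun_prop)
  | @comp d e e' A₂ A₁ ih₂ ih₁ =>
    intro c f p hp h hh
    have h₁ := ih₁ hp (h := fun z => Fin.append z.1 z.2)
      (continuous_finAppend continuous_fst continuous_snd)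
    have h₂ := ih₂ (p := fun (y : Fin (c + e) → ℝ) a => y (Fin.natAdd c a)) (by fun_prop)
      (h := fun z => h (fun a => z.1 (Fin.castAdd e a), z.2)) (by fun_prop)
    have h₃ := TrunkApprox.comp hσ h₂ h₁
    simp only [Fin.append_left, Fin.append_right] at h₃
    exact h₃

/-! ### From limits of trunks to actual networks. -/

theorem TrunkApprox.exists_near {σ : ℝ → ℝ} {k d e : ℕ}
    {F : (n : ℕ) → TupleTensor n k d → TupleTensor n k e} (hF : TrunkApprox σ F) {n : ℕ}
    {S : Set (TupleTensor n k d)} (hS : IsCompact S) {ε : ℝ} (hε : 0 < ε) :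
    ∃ N : IGNTrunk k d e, ∀ X ∈ S, ∀ i c, |N.eval σ X i c - F n X i c| < ε := by
  obtain ⟨G, hG, hGF⟩ := hF
  have h : G n ∈ closure ((fun G : TensorFamily k d e => G n) '' trunkFamilies σ k d e) :=
    map_mem_closure (continuous_apply n) hG fun G hG => Set.mem_image_of_mem _ hG
  obtain ⟨_, ⟨G', ⟨N, hN⟩, rfl⟩, hd⟩ := mem_closure_iff_compact.1 h S hS ε hε
  refine ⟨N, fun X hX i c => ?_⟩
  rw [← hGF, ← hN, ← Real.dist_eq, dist_comm]
  exact ((dist_le_pi_dist _ _ c).trans (dist_le_pi_dist _ _ i)).trans_lt (hd X hX)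

/-- A trunk as a network with residual connections. -/
def IGNTrunk.toResIGN {k d e : ℕ} : IGNTrunk k d e → ResIGN k d e
  | .last L => .lin L
  | .layer L N => .comp N.toResIGN (.comp (.act _) (.lin L))

theorem IGNTrunk.toResIGN_eval (σ : ℝ → ℝ) {k d e n : ℕ} (N : IGNTrunk k d e)
    (X : TupleTensor n k d) : N.toResIGN.eval σ X = N.eval σ X := by
  induction N with
  | last L => rfl
  | layer L N ih => exact ih _

/-- Having different sums in coordinate `c` is an open condition on a family, involving only its
members at `n` and `n'`, so some trunk satisfies it. The invariant layer then sums coordinate `c`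
and the final MLP is the identity. -/
theorem TrunkApprox.exists_ign_eval_ne {σ : ℝ → ℝ} {k d e n n' : ℕ}
    {F : (n : ℕ) → TupleTensor n k d → TupleTensor n k e} (hF : TrunkApprox σ F)
    (X : TupleTensor n k d) (X' : TupleTensor n' k d)
    (h : ∑ i, F n X i ≠ ∑ i, F n' X' i) :
    ∃ N : IGN k d, N.eval σ X ≠ N.eval σ X' := by
  obtain ⟨c, hc⟩ := Function.ne_iff.1 h
  obtain ⟨G, hG, hGF⟩ := hF
  simp only [Finset.sum_apply, ← hGF] at hc
  have hcont : ∀ (n : ℕ) (X : TupleTensor n k d),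
      Continuous fun G : TensorFamily k d e => ∑ i, G n X i c := fun n X => by
    refine continuous_finsetSum _ fun i _ => ?_
    exact (continuous_apply_apply i c).comp
      ((continuous_eval_const X).comp (continuous_apply n))
  obtain ⟨G', hne, N, hN⟩ := mem_closure_iff.1 hG {G | ∑ i, G n X i c ≠ ∑ i, G n' X' i c}
    (isOpen_ne_fun (hcont n X) (hcont n' X')) hc
  refine ⟨⟨e, N, ⟨fun _ => Matrix.of fun r _ => if r = c then 1 else 0, 0⟩, .affine 1 0⟩, ?_⟩
  simpa [IGN.eval, MLP.eval, EquivLayer.eval_apply, Matrix.vecMul, dotProduct, hN] using hne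

/-! ### Kernelized transformers only see the multiset of tuple features -/

/-- Here `π` is any bijection of tuples, not necessarily induced by one of nodes: attention ignores
how tuples overlap. This is the weakness that the strictness part exploits. -/
theorem KernelHead.eval_comp_equiv {d v n n' k : ℕ} (A : KernelHead d v) (X : TupleTensor n' k d)
    (π : (Fin k → Fin n) ≃ (Fin k → Fin n')) (i : Fin k → Fin n) :
    A.eval (fun j => X (π j)) i = A.eval X (π i) := by
  simp only [KernelHead.eval]
  rw [π.sum_comp fun j => A.φ.eval (X j ᵥ* A.K + A.bK),
    π.sum_comp fun j => vecMulVec (A.φ.eval (X j ᵥ* A.K + A.bK)) (X j ᵥ* A.V + A.bV)]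

theorem KernelTransformer.eval_comp_equiv (σ : ℝ → ℝ) {d e n n' k : ℕ} (A : KernelTransformer d e)
    (X : TupleTensor n' k d) (π : (Fin k → Fin n) ≃ (Fin k → Fin n')) :
    A.eval σ (fun j => X (π j)) = fun i => A.eval σ X (π i) := by
  induction A with
  | attn H head O =>
    funext i
    simp only [KernelTransformer.eval, KernelHead.eval_comp_equiv]
  | mlp M => rfl
  | res A ih =>
    funext i
    simp only [KernelTransformer.eval, Pi.add_apply, ih]
  | comp A₂ A₁ ih₂ ih₁ => simp only [KernelTransformer.eval, ih₁, ih₂]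

theorem not_kernelTransformerDistinguishes_of_equiv (σ : ℝ → ℝ) {k n n' a : ℕ} (G : AttrGraph n a)
    (G' : AttrGraph n' a) (π : (Fin k → Fin n) ≃ (Fin k → Fin n'))
    (h : ∀ i, G.tupleInit k i = G'.tupleInit k (π i)) :
    ¬ KernelTransformerDistinguishes σ k G G' := by
  rintro ⟨A, hA⟩
  apply hA
  have h' : G.tupleInit k = fun i => G'.tupleInit k (π i) := funext h
  rw [GraphKernelTransformer.eval, GraphKernelTransformer.eval, h',
    KernelTransformer.eval_comp_equiv, π.sum_comp fun i => A.net.eval σ (G'.tupleInit k) i]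

/-! ### Disjoint unions of stars indexed by binary words -/

/-- The nodes of a union of stars indexed by the binary words of length `M`: the centre `(s, none)`
of the star of `s`, and its potential leaves `(s, some l)`. -/
abbrev StarNode (M : ℕ) : Type := (Fin M → ZMod 2) × Option (Fin M)

/-- The union of stars: the centre of the star of `s` is joined to the leaves whose label belongs
to the support of `s`. -/
def starGraph (M : ℕ) : SimpleGraph (StarNode M) where
  Adj u v := u.1 = v.1 ∧ ((u.2 = none ∧ ∃ l, v.2 = some l ∧ u.1 l = 1) ∨
    (v.2 = none ∧ ∃ l, u.2 = some l ∧ u.1 l = 1))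
  symm := ⟨by
    rintro u v ⟨h, h'⟩
    exact ⟨h.symm, by rw [← h]; exact h'.symm⟩⟩
  loopless := ⟨by
    rintro u ⟨-, ⟨h, l, hl, -⟩ | ⟨h, l, hl, -⟩⟩ <;> simp [h] at hl⟩

/-- The stars whose word has coordinate sum `ε`. -/
abbrev ParityNode (M : ℕ) (ε : ZMod 2) : Type := {w : StarNode M // ∑ l, w.1 l = ε}

/-- Flipping one letter of the word of a node. -/
def flipLetter {M : ℕ} (x : Fin M) (w : StarNode M) : StarNode M := (w.1 + Pi.single x 1, w.2)

theorem flipLetter_flipLetter {M : ℕ} (x : Fin M) (w : StarNode M) :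
    flipLetter x (flipLetter x w) = w := by
  have h : (Pi.single x 1 + Pi.single x 1 : Fin M → ZMod 2) = 0 := by
    rw [← Pi.single_add, CharTwo.add_self_eq_zero, Pi.single_zero]
  ext1
  · simp [flipLetter, add_assoc, h]
  · rfl

theorem sum_flipLetter {M : ℕ} (x : Fin M) (w : StarNode M) :
    ∑ l, (flipLetter x w).1 l = ∑ l, w.1 l + 1 := by
  simp [flipLetter, Finset.sum_add_distrib]

/-- Adjacency reads the word only at the label of the leaf involved, and that label is not `x`. -/
theorem starGraph_adj_flipLetter {M : ℕ} {x : Fin M} {u v : StarNode M} (hu : u.2 ≠ some x)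
    (hv : v.2 ≠ some x) :
    (starGraph M).Adj (flipLetter x u) (flipLetter x v) ↔ (starGraph M).Adj u v := by
  have h : ∀ {o : Option (Fin M)}, o ≠ some x →
      ((∃ l, o = some l ∧ (u.1 + Pi.single x 1 : Fin M → ZMod 2) l = 1) ↔
        ∃ l, o = some l ∧ u.1 l = 1) := fun {o} ho => by
    refine exists_congr fun l => and_congr_right fun hl => ?_
    have hlx : l ≠ x := fun h => ho (h ▸ hl)
    simp [hlx]
  simp only [starGraph, flipLetter, add_left_inj, h hu, h hv]

/-- Fewer than `M` nodes leave a leaf label unused. -/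
theorem exists_unused_label {k : ℕ} (o : Fin k → Option (Fin (k + 1))) :
    ∃ x, ∀ r, o r ≠ some x := by
  by_contra! h
  choose f hf using h
  have hinj : Function.Injective f := fun x y hxy => by
    have := hf x
    rw [hxy, hf y] at this
    exact (Option.some_injective _ this).symm
  simpa using Fintype.card_le_of_injective f hinj

/-- A leaf label that does not occur in a tuple. -/
def unusedLabel {k : ℕ} (o : Fin k → Option (Fin (k + 1))) : Fin (k + 1) :=
  (exists_unused_label o).choose

theorem ne_unusedLabel {k : ℕ} (o : Fin k → Option (Fin (k + 1))) (r : Fin k) :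
    o r ≠ some (unusedLabel o) := (exists_unused_label o).choose_spec r

/-- Flipping the letter at a label that does not occur in a tuple, at every entry of the tuple. -/
def flipTuple {k : ℕ} (ε : ZMod 2) (i : Fin k → ParityNode (k + 1) ε) :
    Fin k → ParityNode (k + 1) (ε + 1) := fun r =>
  ⟨flipLetter (unusedLabel fun r => (i r).1.2) (i r).1, by rw [sum_flipLetter, (i r).2]⟩

/-- The tuples of nodes of even stars correspond to those of odd stars. -/
def flipTupleEquiv (k : ℕ) : (Fin k → ParityNode (k + 1) 0) ≃ (Fin k → ParityNode (k + 1) 1) where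
  toFun i r := ⟨(flipTuple 0 i r).1, by rw [(flipTuple 0 i r).2, zero_add]⟩
  invFun i r := ⟨(flipTuple 1 i r).1, by rw [(flipTuple 1 i r).2]; decide⟩
  -- Flipping leaves the labels of a tuple unchanged, so both directions choose the same unused
  -- label and the flip undoes itself.
  left_inv i := by
    funext r
    exact Subtype.ext (flipLetter_flipLetter _ _)
  right_inv i := by
    funext r
    exact Subtype.ext (flipLetter_flipLetter _ _)

/-- Flipping the first letter. -/
def flipNodeEquiv (k : ℕ) : ParityNode (k + 1) 0 ≃ ParityNode (k + 1) 1 where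
  toFun w := ⟨flipLetter 0 w.1, by rw [sum_flipLetter, w.2, zero_add]⟩
  invFun w := ⟨flipLetter 0 w.1, by rw [sum_flipLetter, w.2]; decide⟩
  left_inv w := Subtype.ext (flipLetter_flipLetter _ _)
  right_inv w := Subtype.ext (flipLetter_flipLetter _ _)

/-- The union of the stars of one parity, with nodes numbered and zero attributes. -/
def parityGraph {M n : ℕ} (a : ℕ) {ε : ZMod 2} (E : ParityNode M ε ≃ Fin n) : AttrGraph n a where
  graph := (starGraph M).comap fun u => (E.symm u).1
  attr := 0

theorem AttrGraph.pairFeature_congr {n n' a : ℕ} {G : AttrGraph n a} {G' : AttrGraph n' a}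
    {u v : Fin n} {u' v' : Fin n'} (heq : u = v ↔ u' = v')
    (hadj : G.graph.Adj u v ↔ G'.graph.Adj u' v') (hG : G.attr = 0) (hG' : G'.attr = 0) :
    G.pairFeature u v = G'.pairFeature u' v' := by
  by_cases h : G'.graph.Adj u' v'
  · simp [AttrGraph.pairFeature, heq, h, hadj.2 h, hG, hG']
  · simp [AttrGraph.pairFeature, heq, h, mt hadj.1 h, hG, hG']

theorem parityGraph_not_kernelTransformerDistinguishes (σ : ℝ → ℝ) {k n a : ℕ}
    (E₀ : ParityNode (k + 1) 0 ≃ Fin n) (E₁ : ParityNode (k + 1) 1 ≃ Fin n) :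
    ¬ KernelTransformerDistinguishes σ k (parityGraph a E₀) (parityGraph a E₁) := by
  refine not_kernelTransformerDistinguishes_of_equiv σ _ _
    (((Equiv.refl _).arrowCongr E₀).symm.trans
      ((flipTupleEquiv k).trans ((Equiv.refl _).arrowCongr E₁))) fun i => ?_
  set j : Fin k → ParityNode (k + 1) 0 := fun r => E₀.symm (i r) 
  funext c
  set r := (finProdFinEquiv.symm (finProdFinEquiv.symm c).1).1
  set s := (finProdFinEquiv.symm (finProdFinEquiv.symm c).1).2
  have heq : i r = i s ↔ E₁ (flipTupleEquiv k j r) = E₁ (flipTupleEquiv k j s) := by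
    rw [E₁.apply_eq_iff_eq, ← E₀.symm.apply_eq_iff_eq, Subtype.ext_iff, Subtype.ext_iff]
    refine ⟨fun h => congrArg (flipLetter _) h, fun h => ?_⟩
    have := congrArg (flipLetter (unusedLabel fun r => (j r).1.2)) h
    exact (flipLetter_flipLetter _ _).symm.trans (this.trans (flipLetter_flipLetter _ _))
  have hadj : (parityGraph a E₀).graph.Adj (i r) (i s) ↔
      (parityGraph a E₁).graph.Adj (E₁ (flipTupleEquiv k j r)) (E₁ (flipTupleEquiv k j s)) := by
    simp only [parityGraph, SimpleGraph.comap_adj, Equiv.symm_apply_apply]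
    exact (starGraph_adj_flipLetter (ne_unusedLabel (fun r => (j r).1.2) r)
      (ne_unusedLabel (fun r => (j r).1.2) s)).symm
  exact congrFun (AttrGraph.pairFeature_congr heq hadj rfl rfl) _

/-! ### Invariant graph networks see degrees -/

open Classical in
/-- The degree of a node, as a real number. -/
def AttrGraph.realDegree {n a : ℕ} (G : AttrGraph n a) (u : Fin n) : ℝ :=
  ∑ v, if G.graph.Adj u v then 1 else 0

open Classical in
/-- The layer that maps the tensor of a graph to the degree of the first node of each tuple. -/
def degreeLayer (m a : ℕ) :
    EquivLayer (m + 2) (m + 2) ((m + 2) * (m + 2) * (a + 2)) 1 where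
  -- The selected input tuples are `(u, v, …, v)` with `u` the first output node, one for each node
  -- `v`; the weight reads the adjacency channel of positions `0` and `1`, hence the order at least
  -- 2.
  w μ := if μ (Sum.inl 0) (Sum.inr 0) ∧ ∀ r, r ≠ 0 → μ (Sum.inr r) (Sum.inr 1) then
    Matrix.of fun c _ => if c = finProdFinEquiv (finProdFinEquiv (0, 1), Fin.natAdd a 0) then 1
      else 0 else 0
  b := 0

theorem AttrGraph.tupleInit_apply {n a k : ℕ} (G : AttrGraph n a) (i : Fin k → Fin n)
    (r s : Fin k) (c : Fin (a + 2)) :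
    G.tupleInit k i (finProdFinEquiv (finProdFinEquiv (r, s), c)) =
      G.pairFeature (i r) (i s) c := by
  simp only [AttrGraph.tupleInit, Equiv.symm_apply_apply]

theorem degreeLayer_eval {m n a : ℕ} (G : AttrGraph n a) (i : Fin (m + 2) → Fin n) (c : Fin 1) :
    (degreeLayer m a).eval (G.tupleInit (m + 2)) i c = G.realDegree (i 0) := by
  classical
  have hterm : ∀ j : Fin (m + 2) → Fin n,
      (G.tupleInit (m + 2) j ᵥ* (degreeLayer m a).w (Setoid.ker (Sum.elim i j))) c =
      if i 0 = j 0 ∧ ∀ r, r ≠ 0 → j r = j 1 then (if G.graph.Adj (j 0) (j 1) then 1 else 0)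
        else 0 := fun j => by
    simp only [degreeLayer, Setoid.ker_def, Sum.elim_inl, Sum.elim_inr]
    split_ifs with h1 h2
    · simp [Matrix.vecMul, dotProduct, AttrGraph.tupleInit_apply, AttrGraph.pairFeature, h2]
    · simp [Matrix.vecMul, dotProduct, AttrGraph.tupleInit_apply, AttrGraph.pairFeature, h2]
    · simp
  rw [EquivLayer.eval_apply, Pi.add_apply, Finset.sum_apply,
    Finset.sum_congr rfl fun j _ => hterm j, ← Finset.sum_filter, AttrGraph.realDegree]
  simp only [degreeLayer, Pi.zero_apply, add_zero]
  refine Finset.sum_nbij' (fun j => j 1) (fun v r => if r = 0 then i 0 else v) ?_ ?_ ?_ ?_ ?_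
  · simp
  · intro v _
    simp +contextual
  · intro j hj
    obtain ⟨h0, h1⟩ := (Finset.mem_filter.1 hj).2
    funext r
    split_ifs with hr
    · rw [hr, h0]
    · exact (h1 r hr).symm
  · simp
  · intro j hj
    rw [(Finset.mem_filter.1 hj).2.1]

/-- A centre meets one leaf for each letter `1` of its word, while a potential leaf can only meet
the centre of its own star. -/
theorem realDegree_parityGraph {M n a : ℕ} {ε : ZMod 2} (E : ParityNode M ε ≃ Fin n)
    (w : ParityNode M ε) :
    (∀ s, w.1 = (s, none) →
      (parityGraph a E).realDegree (E w) = ((Finset.univ.filter fun l => s l = 1).card : ℝ)) ∧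
    (w.1.2 ≠ none → (parityGraph a E).realDegree (E w) ≤ 1) := by
  classical
  have hdeg : (parityGraph a E).realDegree (E w) =
      ((Finset.univ.filter fun v : ParityNode M ε => (starGraph M).Adj w.1 v.1).card : ℝ) := by
    rw [AttrGraph.realDegree, ← E.sum_comp, Finset.natCast_card_filter]
    simp [parityGraph]
  rw [hdeg]
  refine ⟨fun s hs => ?_, fun hw => ?_⟩
  · congr 1
    symm
    have hsum : ∑ l, s l = ε := by simpa [hs] using w.2
    refine Finset.card_bij (fun l _ => (⟨(s, some l), hsum⟩ : ParityNode M ε)) ?_ ?_ ?_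
    · intro l hl
      simpa [starGraph, hs] using hl
    · intro l _ l' _ h
      simpa using h
    · rintro ⟨⟨t, o⟩, ht⟩ hv
      simp only [starGraph, hs, Finset.mem_filter, Finset.mem_univ, true_and] at hv
      obtain ⟨rfl, ⟨l, rfl, hl⟩ | ⟨-, l, hl, -⟩⟩ := hv
      · exact ⟨l, by simpa using hl, rfl⟩
      · simp at hl
  · have : (Finset.univ.filter fun v : ParityNode M ε => (starGraph M).Adj w.1 v.1).card ≤ 1 := by
      refine Finset.card_le_one.2 fun u hu v hv => ?_
      obtain ⟨-, hu1, ⟨hu2, -⟩ | ⟨hu2, -⟩⟩ := Finset.mem_filter.1 hu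
      · exact absurd hu2 hw
      obtain ⟨-, hv1, ⟨hv2, -⟩ | ⟨hv2, -⟩⟩ := Finset.mem_filter.1 hv
      · exact absurd hv2 hw
      exact Subtype.ext (Prod.ext (hu1.symm.trans hv1) (hu2.trans hv2.symm))
    exact_mod_cast this

theorem sum_eq_card_filter_eq_one {M : ℕ} (s : Fin M → ZMod 2) :
    ∑ l, s l = ((Finset.univ.filter fun l => s l = 1).card : ZMod 2) := by
  rw [Finset.natCast_card_filter]
  refine Finset.sum_congr rfl fun l _ => ?_
  generalize s l = z
  revert z
  decide

theorem parityGraph_ignDistinguishes {σ : C(ℝ, ℝ)} (hσ : ¬ ∃ a b : ℝ, ∀ x, σ x = a * x + b)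
    {m n a : ℕ} (E₀ : ParityNode (m + 2 + 1) 0 ≃ Fin n) (E₁ : ParityNode (m + 2 + 1) 1 ≃ Fin n) :
    IGNDistinguishes σ (m + 2) (parityGraph a E₀) (parityGraph a E₁) := by
  -- A bump that is `1` at `2` and vanishes at distance at least 1 from `2`: it ignores odd degrees
  -- and degrees at most 1, hence the whole odd graph.
  let f : ℝ → ℝ := fun x => max 0 (1 - |x - 2|)
  have hf0 : ∀ x, 0 ≤ f x := fun x => le_max_left _ _
  have happ : TrunkApprox σ (k := m + 2) fun _ X i (_ : Fin 1) =>
      f ((degreeLayer m a).eval X i 0) :=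
    TrunkApprox.comp hσ (tuplewiseApprox_of_continuous hσ (m + 2)
      (f := fun (y : Fin 1 → ℝ) (_ : Fin 1) => f (y 0)) (by fun_prop))
      (trunkApprox_layer σ (degreeLayer m a))
  refine happ.exists_ign_eval_ne _ _ fun h => ?_
  have h := congrFun h 0
  simp only [Finset.sum_apply, degreeLayer_eval] at h
  have hodd : ∀ i : Fin (m + 2) → Fin n, f ((parityGraph a E₁).realDegree (i 0)) = 0 := by
    intro i
    obtain ⟨w, hw⟩ := E₁.surjective (i 0)
    rw [← hw]
    obtain ⟨h1, h2⟩ := realDegree_parityGraph (a := a) E₁ w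
    refine max_eq_left ?_
    rcases hs : w.1.2 with _ | l
    · rw [h1 w.1.1 (Prod.ext rfl hs)]
      have hpar := w.2
      rw [sum_eq_card_filter_eq_one] at hpar
      set N := (Finset.univ.filter fun l => w.1.1 l = 1).card
      have hN : N ≠ 2 := fun hN => by rw [hN] at hpar; exact absurd hpar (by decide)
      have : (1 : ℝ) ≤ |(N : ℝ) - 2| := by
        have : (1 : ℤ) ≤ |(N : ℤ) - 2| := Int.one_le_abs (by omega)
        exact_mod_cast this
      linarith
    · have := h2 (by simp [hs])
      have := neg_le_abs ((parityGraph a E₁).realDegree (E₁ w) - 2)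
      linarith
  rw [Finset.sum_eq_zero fun i _ => hodd i] at h
  have hzero := (Finset.sum_eq_zero_iff_of_nonneg fun i _ => hf0 _).1 h
  -- An even word of weight 2: the constant tuple at its centre contributes `f 2 = 1` to the sum for
  -- the even graph.
  let s : Fin (m + 2 + 1) → ZMod 2 := fun l => if l = 0 ∨ l = 1 then 1 else 0
  have hs : (Finset.univ.filter fun l => s l = 1) = {0, 1} := by
    ext l
    simp [s]
    tauto
  have hcard : (Finset.univ.filter fun l => s l = 1).card = 2 := by
    rw [hs, Finset.card_pair (by simp)]
  have hsum : ∑ l, s l = 0 := by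
    rw [sum_eq_card_filter_eq_one, hcard]
    decide
  let w : ParityNode (m + 2 + 1) 0 := ⟨(s, none), hsum⟩
  have := hzero (fun _ => E₀ w) (Finset.mem_univ _)
  rw [(realDegree_parityGraph (a := a) E₀ w).1 s rfl, hcard] at this
  norm_num [f] at this

end

theorem mainTheorem5 (σ : ℝ → ℝ) (hσ : Continuous σ) (hσ' : ¬ ∃ a b : ℝ, ∀ x, σ x = a * x + b)
    (k : ℕ) (hk : 1 ≤ k) :
    -- approximation
    (∀ (n d e : ℕ) (A : KernelTransformer d e) (S : Set (TupleTensor n k d)), IsCompact S →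
      ∀ ε : ℝ, 0 < ε → ∃ N : ResIGN k d e, ∀ X ∈ S, ∀ i c,
        |N.eval σ X i c - A.eval σ X i c| < ε) ∧
    -- at most as powerful
    (∀ (a n n' : ℕ) (G : AttrGraph n a) (G' : AttrGraph n' a),
      KernelTransformerDistinguishes σ k G G' → IGNDistinguishes σ k G G') ∧
    -- strictly
    (2 ≤ k → ∀ a : ℕ, ∃ (n : ℕ) (G G' : AttrGraph n a),
      IGNDistinguishes σ k G G' ∧ ¬ KernelTransformerDistinguishes σ k G G') := by
  obtain ⟨τ, rfl⟩ : ∃ τ : C(ℝ, ℝ), τ = σ := ⟨⟨σ, hσ⟩, rfl⟩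
  have happ : ∀ {d e : ℕ} (A : KernelTransformer d e),
      TrunkApprox τ (k := k) fun _ X => A.eval τ X := fun A =>
    A.trunkApprox_eval hσ' continuous_id continuous_snd
  refine ⟨fun n d e A S hS ε hε => ?_, fun a n n' G G' => ?_, fun h2 a => ?_⟩
  · obtain ⟨N, hN⟩ := (happ A).exists_near (n := n) hS hε
    exact ⟨N.toResIGN, fun X hX i c => by rw [IGNTrunk.toResIGN_eval]; exact hN X hX i c⟩
  · rintro ⟨A, hA⟩
    refine (happ A.net).exists_ign_eval_ne _ _ fun h => hA ?_
    rw [GraphKernelTransformer.eval, GraphKernelTransformer.eval, h]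
  · obtain ⟨m, rfl⟩ := Nat.exists_eq_add_of_le' h2
    let E := Fintype.equivFin (ParityNode (m + 2 + 1) 0)
    -- Flipping the first letter matches the two node sets, so both graphs have the same number of
    -- nodes.
    exact ⟨_, parityGraph a E, parityGraph a ((flipNodeEquiv (m + 2)).symm.trans E),
      parityGraph_ignDistinguishes hσ' _ _, parityGraph_not_kernelTransformerDistinguishes τ _ _⟩
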